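/- For $z\in\mathbb C$ and $k\in\mathbb Z$ let $(z)_k=\Gamma(z+k)/\Gamma(z)$ be the Pochhammer symbol, i.e. $(z)_k=z(z+1)\cdots(z+k-1)$ and $(z)_{-k}=1/\big((z-k)(z-k+1)\cdots(z-1)\big)$ for $k\ge 0$. Horn's function $H_1$ is $$H_1(a,b,c,d;x,y)=\sum_{m,n=0}^\infty\frac{(a)_{m-n}(b)_{m+n}(c)_n}{m!\,n!\,(d)_m}x^my^n .$$ Let $D_0\subset\mathbb C^2$ be the set of $(x,y)$ with $2\sqrt{|x||y|}+|y|<1$, $|x|<1$, $|y|<1$, and let $D_1\subset\mathbb C^2$ be the set of $(x,y)$ with $2\sqrt{|1-x||y|}+|y|<1$, $|1-x|<1$, $|y|<1$. Let $a,b,c,d\in\mathbb C$ be such that no Gamma function or Pochhammer symbol below is exceptional: $a\notin\mathbb Z$, $d-b\notin\mathbb Z$, $a+b-d\notin\mathbb Z$, and none of $b$, $d$, $d-a$ is an integer $\le 0$. Put $$S_1(x,y)=\sum_{m,n=0}^\infty\frac{(c)_n(a)_{m-n}(b-d+1)_n(b)_{m+n}}{m!\,n!\,(d-a)_n(a+b-d+1)_m}(1-x)^m(-y)^n,$$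 $$S_2(x,y)=\sum_{m,n=0}^\infty\frac{(c)_n(b-d+1)_n(d-a)_{m+n}(d-b)_{m-n}}{m!\,n!\,(d-a)_n(d-a-b+1)_m}(1-x)^m(-y)^n.$$ 1. The series of $H_1$ converges absolutely on $D_0$, and the series $S_1$ and $S_2$ converge absolutely on $D_1$. 2. For $(x,y)\in D_0\cap D_1$, with the principal branch of the power, $$H_1(a,b,c,d;x,y)=\frac{\Gamma(d)\Gamma(d-a-b)}{\Gamma(d-a)\Gamma(d-b)}S_1(x,y)+(1-x)^{d-a-b}\,\frac{\Gamma(d)\Gamma(a+b-d)}{\Gamma(a)\Gamma(b)}S_2(x,y).\qquad(*)$$ 3. The right-hand side of $(*)$ is the analytic continuation of $H_1$ around $(1,0)$. Precisely, let $D_1'$ be the set of $(x,y)\in D_1$ with $1-x\notin(-\infty,0]$. There is an analytic function $F$ on $D_0\cup D_1'$ which equals $H_1$ on $D_0$, and every such $F$ equals the right-hand side of $(*)$, with the principal branch of the power, on $D_1'$. 4. The same holds for all branches of the power: let $W$ be the set of $(w,y)\in\mathbb C^2$ with $(1-e^w,y)\in D_1$. There is an analytic function $G$ on $W$ such that $G(w,y)=H_1(a,b,c,d;1-e^w,y)$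 whenever $(w,y)\in W$, $|\operatorname{Im}w|<\pi$ and $(1-e^w,y)\in D_0$; and every such $G$ satisfies, for all $(w,y)\in W$, $$G(w,y)=\frac{\Gamma(d)\Gamma(d-a-b)}{\Gamma(d-a)\Gamma(d-b)}S_1(1-e^w,y)+e^{(d-a-b)w}\,\frac{\Gamma(d)\Gamma(a+b-d)}{\Gamma(a)\Gamma(b)}S_2(1-e^w,y).$$ -/

import Mathlib

open scoped Nat

noncomputable section

/-- The Pochhammer symbol `(z)_k = Γ(z + k) / Γ(z)` with integer index `k`, as a finite product:
`(z)_k = z (z + 1) ⋯ (z + k - 1)` and `(z)_{-k} = 1 / ((z - k) (z - k + 1) ⋯ (z - 1))`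
for `k ≥ 0`. -/
def poch (z : ℂ) : ℤ → ℂ
  | Int.ofNat k => (ascPochhammer ℂ k).eval z
  | Int.negSucc k => ((ascPochhammer ℂ (k + 1)).eval (z - ((k + 1 : ℕ) : ℂ)))⁻¹

/-- The `(m, n)` term of the double series of Horn's function `H₁(a, b, c, d; x, y)`. -/
def hornH1Term (a b c d x y : ℂ) (p : ℕ × ℕ) : ℂ :=
  poch a ((p.1 : ℤ) - p.2) * poch b ((p.1 : ℤ) + p.2) * poch c p.2 /
    ((p.1)! * (p.2)! * poch d p.1) * x ^ p.1 * y ^ p.2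

/-- Horn's function `H₁(a, b, c, d; x, y)`, as the sum of its double series. -/
def hornH1 (a b c d x y : ℂ) : ℂ :=
  ∑' p : ℕ × ℕ, hornH1Term a b c d x y p

/-- The region `2 √(|x| |y|) + |y| < 1`, `|x| < 1`, `|y| < 1` in `ℂ²`. -/
def hornH1Region : Set (ℂ × ℂ) :=
  {q | 2 * Real.sqrt (‖q.1‖ * ‖q.2‖) + ‖q.2‖ < 1 ∧ ‖q.1‖ < 1 ∧ ‖q.2‖ < 1}

/-- The `(m, n)` term of the first double series in powers of `1 - x` and `-y`. -/
def at10Term₁ (a b c d x y : ℂ) (p : ℕ × ℕ) : ℂ :=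
  poch c p.2 * poch a ((p.1 : ℤ) - p.2) * poch (b - d + 1) p.2 * poch b ((p.1 : ℤ) + p.2) /
    ((p.1)! * (p.2)! * poch (d - a) p.2 * poch (a + b - d + 1) p.1) *
    (1 - x) ^ p.1 * (-y) ^ p.2

/-- The `(m, n)` term of the second double series in powers of `1 - x` and `-y`. -/
def at10Term₂ (a b c d x y : ℂ) (p : ℕ × ℕ) : ℂ :=
  poch c p.2 * poch (b - d + 1) p.2 * poch (d - a) ((p.1 : ℤ) + p.2) *
      poch (d - b) ((p.1 : ℤ) - p.2) /
    ((p.1)! * (p.2)! * poch (d - a) p.2 * poch (d - a - b + 1) p.1) *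
    (1 - x) ^ p.1 * (-y) ^ p.2

/-- The region of `ℂ²` on which the two series in `1 - x` and `-y` are considered. -/
def at10Region : Set (ℂ × ℂ) :=
  {q | (1 - q.1, -q.2) ∈ hornH1Region}

/-- The right-hand side of the connection formula around `(1, 0)`, as a function of `(x, y)` and of
the chosen value `P` of the power `(1 - x) ^ (d - a - b)`. -/
def at10Sum (a b c d P x y : ℂ) : ℂ :=
  Complex.Gamma d * Complex.Gamma (d - a - b) /
      (Complex.Gamma (d - a) * Complex.Gamma (d - b)) * (∑' p : ℕ × ℕ, at10Term₁ a b c d x y p) +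
    P * (Complex.Gamma d * Complex.Gamma (a + b - d) /
      (Complex.Gamma a * Complex.Gamma b)) * (∑' p : ℕ × ℕ, at10Term₂ a b c d x y p)

end

/-!
# Connection formula for Horn's function `H₁` around `(1, 0)`

Summation over `m` writes `H₁` as
`∑ n, (a)_{-n} (b)_n (c)_n / n! * y ^ n * ₂F₁ (a - n) (b + n) d x` (`hasSum_hornCoeff`), and the two
series in powers of `1 - x` and `-y` are of the same kind. As `(a - n) + (b + n)` does not depend on
`n`, the connection formula of `₂F₁` between the singular points `0` and `1` has the same exponent
`d - a - b` for all `n`. Its Gamma factors change with `n` by Pochhammer symbols, and summation over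
`n` gives the connection formula of `H₁` wherever all series converge (`hornH1_eq_at10Sum`).

The connection formula of `₂F₁` (`HGGeneric.eq_hgU_add_hgV`) is proved on the lens `|x| < 1`,
`|1 - x| < 1` as follows. The functions `₂F₁ A B C` and `₂F₁ A B (C + 1)` satisfy a first order
system (`IsHGPair`), and so do the pairs formed by the two normalized solutions at `1` and by the
right-hand side of Euler's transformation. The Wronskian of two solutions is an explicit function up
to a constant, which can be read off at `0` or `1`; if it vanishes, the solutions are proportional.
The second function of a pair determines the first one, so that every identity between solutions
for `C + 1` implies the one for `C`, and `C` may be assumed large. There the value of `₂F₁` at `1`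
is given by Gauss' theorem, which follows from the recursion in `C` and the limit `C → ∞`. This
yields the coefficient of the solution of exponent `0` at `1`. Euler's transformation exchanges the
two solutions at `1`, and so yields the other coefficient.

For convergence, the coefficient of `x ^ m * y ^ n` is, up to factors of subexponential growth,
`(m + n)! (m - n)! / m! ^ 2` for `n ≤ m` and `(m + n)! / ((n - m)! m! ^ 2)` for `m ≤ n`
(`hornMajorant`). Both parts are summable under `2 √(X Y) + Y < 1` and `X < 1`
(`summable_hornMajorant`). A double series that converges absolutely on a polydisc is analytic
there.

The continuation statements follow from the identity theorem: the regions are connected, since they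
contract in the `y` direction to the slice `y = 0`, which is star-shaped or convex in the coordinate
`1 - x` or `w`.
-/

noncomputable section

open Filter Topology Set

/-! ### Subexponential growth and power series -/

/-- Growth slower than every exponential `q ^ n` with `q > 1`. For a power series this says that the
radius of convergence is at least one, in a form that is stable under products. -/
def SubExp (f : ℕ → ℂ) : Prop :=
  ∀ q : ℝ, 1 < q → ∃ K : ℝ, 0 < K ∧ ∀ n, ‖f n‖ ≤ K * q ^ n

namespace SubExp

variable {f g : ℕ → ℂ}

lemma mul (hf : SubExp f) (hg : SubExp g) : SubExp (fun n => f n * g n) := by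
  intro q hq
  have h1 : 1 < √q := by rw [Real.lt_sqrt zero_le_one]; simpa using hq
  obtain ⟨K, hK, hfK⟩ := hf _ h1
  obtain ⟨M, hM, hgM⟩ := hg _ h1
  refine ⟨K * M, by positivity, fun n => ?_⟩
  rw [norm_mul]
  calc ‖f n‖ * ‖g n‖ ≤ (K * √q ^ n) * (M * √q ^ n) := by gcongr; exacts [hfK n, hgM n]
    _ = K * M * (√q * √q) ^ n := by rw [mul_pow]; ring
    _ = K * M * q ^ n := by rw [Real.mul_self_sqrt (by linarith)]

lemma shift (hf : SubExp f) : SubExp (fun n => f (n + 1)) := by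
  intro q hq
  obtain ⟨K, hK, h⟩ := hf q hq
  exact ⟨K * q, by positivity, fun n => (h (n + 1)).trans (by rw [pow_succ']; linarith)⟩

lemma of_ratio {r : ℕ → ℂ} (h : ∀ n, f (n + 1) = r n * f n)
    (hr : Tendsto (fun n => ‖r n‖) atTop (𝓝 1)) :
    SubExp f := by
  intro q hq
  have h1 : ∀ᶠ n in atTop, ‖r n‖ ≤ q := (hr.eventually_lt_const hq).mono fun _ => le_of_lt
  obtain ⟨N, hN⟩ := eventually_atTop.1 h1
  have hq0 : 0 < q := by linarith
  have key : ∀ k, ‖f (N + k)‖ ≤ ‖f N‖ * q ^ k := by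
    intro k
    induction k with
    | zero => simp
    | succ k ih =>
      rw [← add_assoc, h, norm_mul, pow_succ]
      calc ‖r (N + k)‖ * ‖f (N + k)‖ ≤ q * (‖f N‖ * q ^ k) := by
            gcongr; exact hN _ (by omega)
        _ = _ := by ring
  refine ⟨1 + ∑ i ∈ Finset.range (N + 1), ‖f i‖, by positivity, fun n => ?_⟩
  have hs : ∀ i ≤ N, ‖f i‖ ≤ 1 + ∑ i ∈ Finset.range (N + 1), ‖f i‖ := fun i hi => by
    have := Finset.single_le_sum (f := fun i => ‖f i‖) (fun i _ => norm_nonneg _)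
      (Finset.mem_range.2 (Nat.lt_succ_of_le hi))
    linarith
  rcases le_total n N with hn | hn
  · exact (hs n hn).trans (le_mul_of_one_le_right (by positivity) (one_le_pow₀ hq.le))
  · obtain ⟨k, rfl⟩ := Nat.exists_eq_add_of_le hn
    calc ‖f (N + k)‖ ≤ ‖f N‖ * q ^ k := key k
      _ ≤ _ := by
        gcongr
        · exact hs N le_rfl
        · exact hq.le
        · omega

lemma natCast_add_one : SubExp (fun n => (n : ℂ) + 1) := by
  intro q hq
  have h0 : 0 < q - 1 := by linarith
  refine ⟨1 + (q - 1)⁻¹, by positivity, fun n => ?_⟩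
  have h := one_add_mul_le_pow (a := q - 1) (by linarith) n
  rw [add_sub_cancel] at h
  have hn : ‖(n : ℂ) + 1‖ = n + 1 := by
    rw [← Nat.cast_succ, Complex.norm_natCast]; simp
  rw [hn]
  have h2 : (n : ℝ) ≤ (q - 1)⁻¹ * q ^ n := by
    rw [← div_eq_inv_mul, le_div_iff₀ h0]; linarith
  nlinarith [one_le_pow₀ hq.le (n := n)]

lemma natCast_mul (hf : SubExp f) : SubExp (fun n => n * f n) := by
  intro q hq
  obtain ⟨K, hK, h⟩ := natCast_add_one.mul hf q hq
  refine ⟨K, hK, fun n => le_trans ?_ (h n)⟩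
  rw [norm_mul, norm_mul, ← Nat.cast_succ, Complex.norm_natCast, Complex.norm_natCast]
  gcongr
  simp

lemma deriv (hf : SubExp f) : SubExp (fun n => ((n : ℂ) + 1) * f (n + 1)) :=
  natCast_add_one.mul hf.shift

lemma summable (hf : SubExp f) {x : ℝ} (h0 : 0 ≤ x) (h1 : x < 1) :
    Summable fun n => ‖f n‖ * x ^ n := by
  obtain ⟨r, hr, hr1⟩ := exists_between h1
  have hr0 : 0 < r := by linarith
  obtain ⟨K, hK, h⟩ := hf r⁻¹ ((one_lt_inv₀ hr0).2 hr1)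
  refine Summable.of_nonneg_of_le (fun n => by positivity) (fun n => ?_)
    ((summable_geometric_of_lt_one (r := x / r) (by positivity)
      ((div_lt_one hr0).2 hr)).mul_left K)
  calc ‖f n‖ * x ^ n ≤ K * r⁻¹ ^ n * x ^ n := by gcongr; exact h n
    _ = K * (x / r) ^ n := by rw [div_eq_inv_mul, mul_pow]; ring

lemma hasSum (hf : SubExp f) {x : ℂ} (hx : ‖x‖ < 1) :
    HasSum (fun n => f n * x ^ n) (∑' n, f n * x ^ n) := by
  refine (Summable.of_norm ?_).hasSum
  simpa only [norm_mul, norm_pow] using hf.summable (norm_nonneg x) hx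

lemma tsum_eq_zero_add (hf : SubExp f) {x : ℂ} (hx : ‖x‖ < 1) :
    ∑' n, f n * x ^ n = f 0 + x * ∑' n, f (n + 1) * x ^ n := by
  rw [(hf.hasSum hx).summable.tsum_eq_zero_add, ← tsum_mul_left]
  simp only [pow_zero, mul_one, pow_succ]
  congr 1
  exact tsum_congr fun n => by ring

lemma hasDerivAt (hf : SubExp f) {x : ℂ} (hx : ‖x‖ < 1) :
    HasDerivAt (fun x : ℂ => ∑' n : ℕ, f n * x ^ n)
      (∑' n : ℕ, ((n : ℂ) + 1) * f (n + 1) * x ^ n) x := by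
  obtain ⟨r, hr, hr1⟩ := exists_between hx
  have hr0 : 0 ≤ r := (norm_nonneg x).trans hr.le
  have hd : HasDerivAt (fun x : ℂ => ∑' n : ℕ, f (n + 1) * x ^ (n + 1))
      (∑' n : ℕ, ((n : ℂ) + 1) * f (n + 1) * x ^ n) x := by
    refine hasDerivAt_tsum_of_isPreconnected (t := Metric.ball 0 r) (y₀ := 0)
      (u := fun n : ℕ => ‖((n : ℂ) + 1) * f (n + 1)‖ * r ^ n)
      (g := fun n (y : ℂ) => f (n + 1) * y ^ (n + 1))
      (g' := fun n (y : ℂ) => ((n : ℂ) + 1) * f (n + 1) * y ^ n) (hf.deriv.summable hr0 hr1)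
      Metric.isOpen_ball (convex_ball _ _).isPreconnected (fun n y _ => ?_) (fun n y hy => ?_)
      (Metric.mem_ball_self ((norm_nonneg x).trans_lt hr)) ?_ (by simpa using hr)
    · convert! (hasDerivAt_pow (n + 1) y).const_mul (f (n + 1)) using 1
      push_cast
      ring
    · rw [norm_mul, norm_pow]
      gcongr
      exact (mem_ball_zero_iff.1 hy).le
    · simp
  have he : (fun x : ℂ => ∑' n : ℕ, f n * x ^ n) =ᶠ[𝓝 x]
      fun x => f 0 + ∑' n, f (n + 1) * x ^ (n + 1) := by
    filter_upwards [(continuous_norm.tendsto x).eventually_lt_const hx] with y hy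
    rw [(hf.hasSum hy).summable.tsum_eq_zero_add]
    simp
  exact (hd.const_add (f 0)).congr_of_eventuallyEq he

end SubExp

/-! ### The Gauss hypergeometric series -/

lemma tendsto_add_natCast_div (z w : ℂ) :
    Tendsto (fun n : ℕ => (z + n) / (w + n)) atTop (𝓝 1) := by
  have h (u : ℂ) : Tendsto (fun n : ℕ => u / (n : ℂ) + 1) atTop (𝓝 1) := by
    simpa using (tendsto_const_div_atTop_nhds_zero_nat u).add_const 1
  have := (h z).div (h w) one_ne_zero
  rw [div_one] at this
  refine this.congr' ?_
  filter_upwards [eventually_ne_atTop 0] with n hn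
  have : (n : ℂ) ≠ 0 := by exact_mod_cast hn
  simp only [Pi.div_apply]
  rw [div_add_one this, div_add_one this, div_div_div_cancel_right₀ this]

/-- The complex number `z` is not a pole of the Gamma function. -/
def NonPole (z : ℂ) : Prop := ∀ k : ℕ, z ≠ -(k : ℂ)

namespace NonPole

variable {z : ℂ}

lemma add_natCast_ne (h : NonPole z) (n : ℕ) : z + n ≠ 0 :=
  fun h' => h n (eq_neg_of_add_eq_zero_left h')

lemma ne_zero (h : NonPole z) : z ≠ 0 := by simpa using h 0

lemma add_nat (h : NonPole z) (n : ℕ) : NonPole (z + n) := fun k hk =>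
  h (n + k) (by push_cast; linear_combination hk)

lemma add_one (h : NonPole z) : NonPole (z + 1) := by simpa using h.add_nat 1

lemma poch_ne_zero (h : NonPole z) (n : ℕ) : (ascPochhammer ℂ n).eval z ≠ 0 := by
  rw [Ne, ascPochhammer_eval_eq_zero_iff]
  rintro ⟨k, -, hk⟩
  exact h k (by rw [hk, neg_neg])

lemma Gamma_ne_zero (h : NonPole z) : Complex.Gamma z ≠ 0 := Complex.Gamma_ne_zero h

lemma of_not_int (h : ∀ k : ℤ, z ≠ k) : NonPole z := fun k => by simpa using h (-k)

lemma of_re_pos (h : 0 < z.re) : NonPole z := fun k hk => by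
  rw [hk] at h
  simp at h
  exact absurd h (by have := k.cast_nonneg (α := ℝ); linarith)

end NonPole

lemma ascPochhammer_eval_add_one (z : ℂ) (n : ℕ) :
    z * (ascPochhammer ℂ n).eval (z + 1) = (ascPochhammer ℂ n).eval z * (z + n) := by
  rw [← ascPochhammer_succ_eval, ascPochhammer_succ_left]
  simp [Polynomial.eval_comp]

/-- Coefficients of the Gauss hypergeometric series. -/
abbrev hgCoeff (A B C : ℂ) (n : ℕ) : ℂ := ordinaryHypergeometricCoefficient A B C n

section Hypergeometric

variable (A B C : ℂ)

lemma hgCoeff_zero : hgCoeff A B C 0 = 1 := by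
  simp [hgCoeff, ordinaryHypergeometricCoefficient]

lemma hgCoeff_succ (n : ℕ) :
    hgCoeff A B C (n + 1) = (A + n) / (C + n) * ((B + n) / (1 + n)) * hgCoeff A B C n := by
  simp only [hgCoeff, ordinaryHypergeometricCoefficient, ascPochhammer_succ_eval,
    Nat.factorial_succ]
  push_cast
  rw [mul_inv, mul_inv]
  ring

lemma subExp_hgCoeff : SubExp (hgCoeff A B C) :=
  .of_ratio (hgCoeff_succ A B C) (by
    simpa using ((tendsto_add_natCast_div A C).mul (tendsto_add_natCast_div B 1)).norm)

lemma hypergeometric_eq_tsum (x : ℂ) : ₂F₁ A B C x = ∑' n, hgCoeff A B C n * x ^ n := by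
  rw [ordinaryHypergeometric_eq_tsum]; rfl

variable {C}

lemma hgCoeff_add_one_right (hC : NonPole C) (n : ℕ) :
    (C + n) * hgCoeff A B (C + 1) n = C * hgCoeff A B C n := by
  have h := ascPochhammer_eval_add_one C n
  have h1 := hC.poch_ne_zero n
  have h2 := hC.add_one.poch_ne_zero n
  simp only [hgCoeff, ordinaryHypergeometricCoefficient]
  field_simp
  linear_combination (-((n ! : ℂ)⁻¹ * (ascPochhammer ℂ n).eval A * (ascPochhammer ℂ n).eval B)) * h

/-- The coefficient form of the derivative of `₂F₁ A B C`. -/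
lemma hgCoeff_add_one_all (hC : NonPole C) (n : ℕ) :
    ((n : ℂ) + 1) * hgCoeff A B C (n + 1) = A * B / C * hgCoeff (A + 1) (B + 1) (C + 1) n := by
  have hC0 := hC.ne_zero
  have hn : (n : ℂ) + 1 ≠ 0 := by exact_mod_cast n.succ_ne_zero
  have h1 := hC.poch_ne_zero n
  have h2 := hC.add_one.poch_ne_zero n
  have h3 := hC.add_natCast_ne n
  rw [hgCoeff_succ]
  have hA := ascPochhammer_eval_add_one A n
  have hB := ascPochhammer_eval_add_one B n
  have h := ascPochhammer_eval_add_one C n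
  have hn' : (1 : ℂ) + n ≠ 0 := by rwa [add_comm]
  simp only [hgCoeff, ordinaryHypergeometricCoefficient]
  have : C * ((ascPochhammer ℂ n).eval (C + 1)) ≠ 0 := mul_ne_zero hC0 h2
  trans ((ascPochhammer ℂ n).eval A * (A + n)) * ((ascPochhammer ℂ n).eval B * (B + n)) *
    ((ascPochhammer ℂ n).eval C * (C + n))⁻¹ * (n ! : ℂ)⁻¹
  · field_simp
    ring
  · rw [← h, ← hA, ← hB]
    field_simp

/-- The coefficient form of `one_sub_mul_deriv_hypergeometric`. The left-hand side telescopes, which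
also gives the recursion behind Gauss' summation theorem. -/
lemma hgCoeff_telescope (hC : NonPole C) (n : ℕ) :
    ((n : ℂ) + 1) * hgCoeff A B C (n + 1) - n * hgCoeff A B C n =
      (C - A) * (C - B) / C * hgCoeff A B (C + 1) n - (C - A - B) * hgCoeff A B C n := by
  have e2 := hgCoeff_add_one_right A B hC n
  have e3 := hgCoeff_succ A B C n
  have hn : (n : ℂ) + 1 ≠ 0 := by exact_mod_cast n.succ_ne_zero
  have hn' : (1 : ℂ) + n ≠ 0 := by rwa [add_comm]
  have hCn := hC.add_natCast_ne n
  have hC0 := hC.ne_zero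
  rw [e3]
  have e4 : hgCoeff A B C n = (C + n) * hgCoeff A B (C + 1) n / C := by
    rw [e2]; field_simp
  rw [e4]
  field_simp
  ring

variable {x : ℂ}

lemma hypergeometric_hasDerivAt (hC : NonPole C) (hx : ‖x‖ < 1) :
    HasDerivAt (₂F₁ A B C) (A * B / C * ₂F₁ (A + 1) (B + 1) (C + 1) x) x := by
  have h := (subExp_hgCoeff A B C).hasDerivAt hx
  simp only [hgCoeff_add_one_all A B hC, mul_assoc (A * B / C), tsum_mul_left,
    ← hypergeometric_eq_tsum] at h
  exact h

/-- Contiguity relation that lowers the third parameter: it expresses `₂F₁ A B C` by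
`₂F₁ A B (C + 1)` and the derivative of the latter. -/
lemma mul_deriv_hypergeometric_add_one (hC : NonPole C) (hx : ‖x‖ < 1) :
    x * ((A * B / (C + 1)) * ₂F₁ (A + 1) (B + 1) (C + 1 + 1) x) =
      C * (₂F₁ A B C x - ₂F₁ A B (C + 1) x) := by
  have h := (subExp_hgCoeff A B (C + 1)).deriv.hasSum hx
  simp only [hgCoeff_add_one_all A B hC.add_one, mul_assoc (A * B / (C + 1)), tsum_mul_left,
    ← hypergeometric_eq_tsum] at h
  rw [hypergeometric_eq_tsum A B C, hypergeometric_eq_tsum A B (C + 1),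
    (subExp_hgCoeff A B C).tsum_eq_zero_add hx, (subExp_hgCoeff A B (C + 1)).tsum_eq_zero_add hx,
    hgCoeff_zero, hgCoeff_zero, add_sub_add_left_eq_sub, ← mul_sub, mul_left_comm C]
  congr 1
  refine h.unique ?_
  convert! (((subExp_hgCoeff A B C).shift.hasSum hx).sub
    ((subExp_hgCoeff A B (C + 1)).shift.hasSum hx)).mul_left C using 2 with n
  have h1 := hgCoeff_add_one_right A B hC (n + 1)
  have h2 := hgCoeff_add_one_all A B hC.add_one n
  push_cast at h1
  rw [← mul_assoc (A * B / (C + 1)), ← h2]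
  linear_combination x ^ n * h1

/-- Contiguity relation that raises the third parameter: it expresses `₂F₁ A B (C + 1)` by
`₂F₁ A B C` and the derivative of the latter. -/
lemma one_sub_mul_deriv_hypergeometric (hC : NonPole C) (hx : ‖x‖ < 1) :
    (1 - x) * ((A * B / C) * ₂F₁ (A + 1) (B + 1) (C + 1) x) =
      (C - A) * (C - B) / C * ₂F₁ A B (C + 1) x - (C - A - B) * ₂F₁ A B C x := by
  have hs := subExp_hgCoeff A B C
  have h := hs.deriv
  have h1 := h.hasSum hx
  simp only [hgCoeff_add_one_all A B hC, mul_assoc (A * B / C), tsum_mul_left,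
    ← hypergeometric_eq_tsum] at h1
  have h2 : SubExp fun n => n * hgCoeff A B C n := hs.natCast_mul
  have h3 := h2.tsum_eq_zero_add hx
  push_cast at h3
  simp only [zero_mul, zero_add, hgCoeff_add_one_all A B hC, mul_assoc (A * B / C), tsum_mul_left,
    ← hypergeometric_eq_tsum] at h3
  rw [one_sub_mul, ← h3]
  refine (h1.sub (h2.hasSum hx)).unique ?_
  rw [hypergeometric_eq_tsum A B C, hypergeometric_eq_tsum A B (C + 1)]
  convert! (((subExp_hgCoeff A B (C + 1)).hasSum hx).mul_left ((C - A) * (C - B) / C)).sub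
    ((hs.hasSum hx).mul_left (C - A - B)) using 2 with n
  rw [← mul_assoc (A * B / C), ← hgCoeff_add_one_all A B hC n]
  linear_combination x ^ n * hgCoeff_telescope A B hC n

/-- Gauss' hypergeometric differential equation, in terms of `₂F₁ A B C` and of the function
`₂F₁ (A + 1) (B + 1) (C + 1)` proportional to its derivative. The form is valid also for
`A * B = 0`. -/
lemma hypergeometric_ode (hC : NonPole C) (hx : ‖x‖ < 1) :
    x * (1 - x) *
        (((A + 1) * (B + 1) / (C + 1)) * ₂F₁ (A + 1 + 1) (B + 1 + 1) (C + 1 + 1) x) =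
      C * (₂F₁ A B C x - ₂F₁ (A + 1) (B + 1) (C + 1) x) +
        (A + B + 1) * x * ₂F₁ (A + 1) (B + 1) (C + 1) x := by
  have hs := subExp_hgCoeff A B C
  have hp := subExp_hgCoeff (A + 1) (B + 1) (C + 1)
  have h1 := hp.deriv.hasSum hx
  have h2 : SubExp fun n => n * hgCoeff (A + 1) (B + 1) (C + 1) n := hp.natCast_mul
  have h3 := h2.tsum_eq_zero_add hx
  push_cast at h3
  have h4 : ∑' n : ℕ, ((n : ℂ) + 1) * hgCoeff (A + 1) (B + 1) (C + 1) (n + 1) * x ^ n =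
      ((A + 1) * (B + 1) / (C + 1)) * ₂F₁ (A + 1 + 1) (B + 1 + 1) (C + 1 + 1) x := by
    simp only [hgCoeff_add_one_all (A + 1) (B + 1) hC.add_one,
      mul_assoc ((A + 1) * (B + 1) / (C + 1)), tsum_mul_left, ← hypergeometric_eq_tsum]
  rw [← h4, mul_assoc, one_sub_mul]
  rw [zero_mul, zero_add] at h3
  rw [← h3, hypergeometric_eq_tsum A B C, hs.tsum_eq_zero_add hx,
    mul_right_comm (A + B + 1) x, mul_comm _ x]
  nth_rw 1 [hypergeometric_eq_tsum (A + 1)]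
  rw [hp.tsum_eq_zero_add hx, hgCoeff_zero, hgCoeff_zero, add_sub_add_left_eq_sub, ← mul_sub,
    mul_left_comm C, ← mul_add]
  congr 1
  refine (h1.sub (h2.hasSum hx)).unique ?_
  rw [hypergeometric_eq_tsum (A + 1)]
  convert! (((hs.shift.hasSum hx).sub (hp.shift.hasSum hx)).mul_left C).add
    ((hp.hasSum hx).mul_left (A + B + 1)) using 2 with n
  have e1 := hgCoeff_add_one_all A B hC n
  have e3 := hgCoeff_succ (A + 1) (B + 1) (C + 1) n
  have hn : (n : ℂ) + 1 ≠ 0 := by exact_mod_cast n.succ_ne_zero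
  have hn' : (1 : ℂ) + n ≠ 0 := by rwa [add_comm]
  have hCn := hC.add_one.add_natCast_ne n
  have hC0 := hC.ne_zero
  have e4 : hgCoeff A B C (n + 1) =
      A * B / C * hgCoeff (A + 1) (B + 1) (C + 1) n / (n + 1) := by
    rw [← e1]; field_simp
  rw [e3, e4]
  field_simp
  ring

end Hypergeometric

/-! ### The first order system of contiguous hypergeometric functions -/

lemma cpow_sub_one_eq {x s : ℂ} (hx : x ≠ 0) : x ^ (s - 1) = x ^ s / x := by
  rw [Complex.cpow_sub _ _ hx, Complex.cpow_one]

lemma cpow_add_one_eq {x s : ℂ} (hx : x ≠ 0) : x ^ (s + 1) = x ^ s * x := by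
  rw [Complex.cpow_add _ _ hx, Complex.cpow_one]

/-- The intersection of the discs of radius one around `0` and around `1`. -/
def hgLens : Set ℂ := {x | ‖x‖ < 1 ∧ ‖1 - x‖ < 1}

lemma isOpen_hgLens : IsOpen hgLens :=
  (isOpen_lt continuous_norm continuous_const).inter
    (isOpen_lt (continuous_const.sub continuous_id).norm continuous_const)

lemma convex_hgLens : Convex ℝ hgLens := by
  have : hgLens = Metric.ball 0 1 ∩ Metric.ball 1 1 := by
    ext x; simp [hgLens, dist_eq_norm, norm_sub_rev x 1]
  rw [this]
  exact (convex_ball _ _).inter (convex_ball _ _)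

lemma mem_slitPlane_of_norm_one_sub_lt {x : ℂ} (h : ‖1 - x‖ < 1) : x ∈ Complex.slitPlane := by
  left
  have := (Complex.re_le_norm (1 - x)).trans_lt h
  simp at this
  exact this

lemma mem_slitPlane_of_mem_hgLens {x : ℂ} (h : x ∈ hgLens) : x ∈ Complex.slitPlane :=
  mem_slitPlane_of_norm_one_sub_lt h.2

lemma one_sub_mem_slitPlane_of_norm_lt {x : ℂ} (h : ‖x‖ < 1) : 1 - x ∈ Complex.slitPlane :=
  mem_slitPlane_of_norm_one_sub_lt (by simpa using h)

lemma ofReal_mem_hgLens {r : ℝ} (h0 : 0 < r) (h1 : r < 1) : (r : ℂ) ∈ hgLens := by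
  have h : (1 : ℂ) - r = ((1 - r : ℝ) : ℂ) := by push_cast; ring
  constructor
  · rw [Complex.norm_real, Real.norm_eq_abs, abs_lt]; constructor <;> linarith
  · rw [h, Complex.norm_real, Real.norm_eq_abs, abs_lt]; constructor <;> linarith

instance neBot_nhdsWithin_hgLens_zero : (𝓝[hgLens] (0 : ℂ)).NeBot := by
  have h : Tendsto (fun r : ℝ => (r : ℂ)) (𝓝[Ioo 0 1] 0) (𝓝[hgLens] (0 : ℂ)) := by
    refine tendsto_nhdsWithin_iff.2 ⟨?_, ?_⟩
    · have := Complex.continuous_ofReal.tendsto 0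
      rw [Complex.ofReal_zero] at this
      exact this.mono_left nhdsWithin_le_nhds
    · filter_upwards [self_mem_nhdsWithin] with r hr using ofReal_mem_hgLens hr.1 hr.2
  have : (𝓝[Ioo (0 : ℝ) 1] 0).NeBot := by
    rw [nhdsWithin_Ioo_eq_nhdsGT zero_lt_one]; infer_instance
  exact h.neBot

instance neBot_nhdsWithin_hgLens_one : (𝓝[hgLens] (1 : ℂ)).NeBot := by
  have h : Tendsto (fun r : ℝ => (r : ℂ)) (𝓝[Ioo 0 1] 1) (𝓝[hgLens] (1 : ℂ)) := by
    refine tendsto_nhdsWithin_iff.2 ⟨?_, ?_⟩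
    · have := Complex.continuous_ofReal.tendsto 1
      rw [Complex.ofReal_one] at this
      exact this.mono_left nhdsWithin_le_nhds
    · filter_upwards [self_mem_nhdsWithin] with r hr using ofReal_mem_hgLens hr.1 hr.2
  have : (𝓝[Ioo (0 : ℝ) 1] 1).NeBot := by
    rw [nhdsWithin_Ioo_eq_nhdsLT zero_lt_one]; infer_instance
  exact h.neBot

/-- A pair `(f, g)` of functions on the lens that satisfies the first order system fulfilled by the
two contiguous functions `₂F₁ A B C` and `₂F₁ A B (C + 1)`. The system is equivalent to Gauss'
hypergeometric equation for `f`; only first derivatives occur in it. -/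
structure IsHGPair (A B C : ℂ) (f g : ℂ → ℂ) : Prop where
  fst : ∀ x ∈ hgLens, ∃ f', HasDerivAt f f' x ∧
    (1 - x) * f' = (C - A) * (C - B) / C * g x - (C - A - B) * f x
  snd : ∀ x ∈ hgLens, ∃ g', HasDerivAt g g' x ∧ x * g' = C * (f x - g x)

namespace IsHGPair

variable {A B C : ℂ} {f g h k : ℂ → ℂ}

lemma sub (H : IsHGPair A B C f g) (H' : IsHGPair A B C h k) :
    IsHGPair A B C (fun x => f x - h x) (fun x => g x - k x) where
  fst x hx := by
    obtain ⟨f', hf, ef⟩ := H.fst x hx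
    obtain ⟨h', hh, eh⟩ := H'.fst x hx
    exact ⟨_, hf.sub hh, by linear_combination ef - eh⟩
  snd x hx := by
    obtain ⟨f', hf, ef⟩ := H.snd x hx
    obtain ⟨h', hh, eh⟩ := H'.snd x hx
    exact ⟨_, hf.sub hh, by linear_combination ef - eh⟩

lemma const_mul (c : ℂ) (H : IsHGPair A B C f g) :
    IsHGPair A B C (fun x => c * f x) (fun x => c * g x) where
  fst x hx := by
    obtain ⟨f', hf, ef⟩ := H.fst x hx
    exact ⟨_, hf.const_mul c, by linear_combination c * ef⟩
  snd x hx := by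
    obtain ⟨f', hf, ef⟩ := H.snd x hx
    exact ⟨_, hf.const_mul c, by linear_combination c * ef⟩

lemma add (H : IsHGPair A B C f g) (H' : IsHGPair A B C h k) :
    IsHGPair A B C (fun x => f x + h x) (fun x => g x + k x) := by
  simpa using H.sub (H'.const_mul (-1))

lemma analyticOnNhd_fst (H : IsHGPair A B C f g) : AnalyticOnNhd ℂ f hgLens := by
  refine DifferentiableOn.analyticOnNhd (fun x hx => ?_) isOpen_hgLens
  obtain ⟨f', hf, -⟩ := H.fst x hx
  exact hf.differentiableAt.differentiableWithinAt

/-- The first function of a pair is determined by the second one. -/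
lemma eqOn_fst (hC : C ≠ 0) (H : IsHGPair A B C f g) (H' : IsHGPair A B C h k)
    (he : ∀ x ∈ hgLens, g x = k x) : ∀ x ∈ hgLens, f x = h x := by
  intro x hx
  obtain ⟨g', hg, eg⟩ := H.snd x hx
  obtain ⟨k', hk, ek⟩ := H'.snd x hx
  have : g =ᶠ[𝓝 x] k := by
    filter_upwards [isOpen_hgLens.mem_nhds hx] with y hy using he y hy
  have hgk := hg.unique (hk.congr_of_eventuallyEq this)
  rw [hgk, ek, he x hx] at eg
  have := mul_left_cancel₀ hC eg
  linear_combination -this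

/-- Abel's formula: the Wronskian of two pairs is a constant multiple of
`x ^ (-C) * (1 - x) ^ (C - A - B)`. -/
lemma wronskian (H : IsHGPair A B C f g) (H' : IsHGPair A B C h k) :
    ∃ κ, ∀ x ∈ hgLens, (f x * k x - g x * h x) * (x ^ C * (1 - x) ^ (-(C - A - B))) = κ := by
  have key : ∀ x ∈ hgLens, HasDerivAt
      (fun x => (f x * k x - g x * h x) * (x ^ C * (1 - x) ^ (-(C - A - B)))) 0 x := by
    intro x hx
    obtain ⟨f', hf, ef⟩ := H.fst x hx
    obtain ⟨g', hg, eg⟩ := H.snd x hx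
    obtain ⟨h', hh, eh⟩ := H'.fst x hx
    obtain ⟨k', hk, ek⟩ := H'.snd x hx
    have hx0 := mem_slitPlane_of_mem_hgLens hx
    have hx1 := one_sub_mem_slitPlane_of_norm_lt hx.1
    have n0 := Complex.slitPlane_ne_zero hx0
    have n1 := Complex.slitPlane_ne_zero hx1
    have p0 := (hasDerivAt_id x).cpow_const (c := C) hx0
    have p1 := ((hasDerivAt_id x).const_sub 1).cpow_const (c := -(C - A - B)) hx1
    convert! ((hf.mul hk).sub (hg.mul hh)).mul (p0.mul p1) using 1
    simp only [id_eq, Pi.mul_apply, Pi.sub_apply]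
    rw [cpow_sub_one_eq n0, cpow_sub_one_eq n1]
    have ef' : f' = ((C - A) * (C - B) / C * g x - (C - A - B) * f x) / (1 - x) := by
      rw [← ef]; field_simp
    have eh' : h' = ((C - A) * (C - B) / C * k x - (C - A - B) * h x) / (1 - x) := by
      rw [← eh]; field_simp
    have eg' : g' = C * (f x - g x) / x := by rw [← eg]; field_simp
    have ek' : k' = C * (h x - k x) / x := by rw [← ek]; field_simp
    rw [ef', eh', eg', ek']
    generalize (C - A) * (C - B) / C = e
    field_simp
    ring
  refine isOpen_hgLens.exists_is_const_of_deriv_eq_zero convex_hgLens.isPreconnected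
    (fun x hx => (key x hx).differentiableAt.differentiableWithinAt) (fun x hx => (key x hx).deriv)

/-- If the Wronskian of two pairs vanishes, then their first functions are proportional. -/
lemma exists_eq_const_mul (H : IsHGPair A B C f g) (H' : IsHGPair A B C h k)
    (hw : ∀ x ∈ hgLens, f x * k x - g x * h x = 0) {x₀ : ℂ} (hx₀ : x₀ ∈ hgLens)
    (h0 : h x₀ ≠ 0) : ∃ κ, ∀ x ∈ hgLens, f x = κ * h x := by
  have hc := (H'.analyticOnNhd_fst x₀ hx₀).continuousAt
  obtain ⟨ε, hε, hb⟩ := Metric.eventually_nhds_iff_ball.1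
    ((hc.eventually_ne h0).and (isOpen_hgLens.mem_nhds hx₀))
  have key : ∀ x ∈ Metric.ball x₀ ε, HasDerivAt (fun x => f x / h x) 0 x := by
    intro x hx
    obtain ⟨hh0, hx⟩ := hb x hx
    obtain ⟨f', hf, ef⟩ := H.fst x hx
    obtain ⟨h', hh, eh⟩ := H'.fst x hx
    have n1 := Complex.slitPlane_ne_zero (one_sub_mem_slitPlane_of_norm_lt hx.1)
    convert! hf.div hh hh0 using 1
    rw [eq_comm, div_eq_zero_iff]
    left
    apply mul_left_cancel₀ n1
    linear_combination h x * ef - f x * eh - (C - A) * (C - B) / C * hw x hx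
  obtain ⟨κ, hκ⟩ := Metric.isOpen_ball.exists_is_const_of_deriv_eq_zero
    (convex_ball x₀ ε).isPreconnected
    (fun x hx => (key x hx).differentiableAt.differentiableWithinAt) (fun x hx => (key x hx).deriv)
  refine ⟨κ, fun x hx => ?_⟩
  refine H.analyticOnNhd_fst.eqOn_of_preconnected_of_eventuallyEq
    (analyticOnNhd_const.mul H'.analyticOnNhd_fst) convex_hgLens.isPreconnected hx₀ ?_ hx
  filter_upwards [Metric.ball_mem_nhds x₀ hε] with y hy
  have := hκ y hy
  rw [div_eq_iff (hb y hy).1] at this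
  exact this

end IsHGPair

/-- Parameters for which no Gamma function in the connection formula is exceptional. -/
structure HGGeneric (A B C : ℂ) : Prop where
  left : NonPole A
  right : NonPole B
  bot : NonPole C
  bot_left : NonPole (C - A)
  bot_right : NonPole (C - B)
  exponent : ∀ k : ℤ, C - A - B ≠ k

namespace HGGeneric

variable {A B C : ℂ}

lemma add_one (h : HGGeneric A B C) : HGGeneric A B (C + 1) where
  left := h.left
  right := h.right
  bot := h.bot.add_one
  bot_left := by rw [add_sub_right_comm]; exact h.bot_left.add_one
  bot_right := by rw [add_sub_right_comm]; exact h.bot_right.add_one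
  exponent k hk := h.exponent (k - 1) (by push_cast; linear_combination hk)

lemma euler (h : HGGeneric A B C) : HGGeneric (C - A) (C - B) C where
  left := h.bot_left
  right := h.bot_right
  bot := h.bot
  bot_left := by rw [sub_sub_cancel]; exact h.left
  bot_right := by rw [sub_sub_cancel]; exact h.right
  exponent k hk := h.exponent (-k) (by push_cast; linear_combination -hk)

lemma nonPole_exponent (h : HGGeneric A B C) (k : ℤ) : NonPole (C - A - B + k) :=
  .of_not_int fun j hj => h.exponent (j - k) (by push_cast; linear_combination hj)

lemma nonPole_neg_exponent (h : HGGeneric A B C) (k : ℤ) : NonPole (A + B - C + k) :=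
  .of_not_int fun j hj => h.exponent (k - j) (by push_cast; linear_combination -hj)

end HGGeneric

/-- The value of `₂F₁ A B C` at `1` according to Gauss' summation theorem. -/
def gaussValue (A B C : ℂ) : ℂ :=
  Complex.Gamma C * Complex.Gamma (C - A - B) / (Complex.Gamma (C - A) * Complex.Gamma (C - B))

lemma gaussValue_add_one {A B C : ℂ} (hC : NonPole C) (hγ : NonPole (C - A - B))
    (hA : NonPole (C - A)) (hB : NonPole (C - B)) :
    (C - A) * (C - B) * gaussValue A B (C + 1) = C * (C - A - B) * gaussValue A B C := by
  have hC0 := hC.ne_zero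
  have hγ0 := hγ.ne_zero
  have h1 := hA.ne_zero
  have h2 := hB.ne_zero
  have h3 := hA.Gamma_ne_zero
  have h4 := hB.Gamma_ne_zero
  unfold gaussValue
  rw [show C + 1 - A - B = C - A - B + 1 by ring, show C + 1 - A = C - A + 1 by ring,
    show C + 1 - B = C - B + 1 by ring, Complex.Gamma_add_one _ hC0,
    Complex.Gamma_add_one _ hγ0, Complex.Gamma_add_one _ h1, Complex.Gamma_add_one _ h2]
  field_simp

/-- The solution at `1` of exponent zero, normalized as in the connection formula. -/
def hgU (A B C x : ℂ) : ℂ := gaussValue A B C * ₂F₁ A B (A + B - C + 1) (1 - x)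

/-- The solution at `1` of exponent `C - A - B`, normalized as in the connection formula. -/
def hgV (A B C x : ℂ) : ℂ :=
  Complex.Gamma C * Complex.Gamma (A + B - C) / (Complex.Gamma A * Complex.Gamma B) *
    ((1 - x) ^ (C - A - B) * ₂F₁ (C - A) (C - B) (C - A - B + 1) (1 - x))

/-- The right-hand side of Euler's transformation of `₂F₁ A B C`. -/
def hgEuler (A B C x : ℂ) : ℂ := (1 - x) ^ (C - A - B) * ₂F₁ (C - A) (C - B) C x

section pairs

variable {A B C : ℂ}

lemma isHGPair_hypergeometric (hC : NonPole C) :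
    IsHGPair A B C (₂F₁ A B C) (₂F₁ A B (C + 1)) where
  fst _ hx := ⟨_, hypergeometric_hasDerivAt A B hC hx.1,
    one_sub_mul_deriv_hypergeometric A B hC hx.1⟩
  snd _ hx := ⟨_, hypergeometric_hasDerivAt A B hC.add_one hx.1,
    mul_deriv_hypergeometric_add_one A B hC hx.1⟩

lemma isHGPair_hgEuler (hC : NonPole C) :
    IsHGPair A B C (hgEuler A B C) (hgEuler A B (C + 1)) where
  fst x hx := by
    have hx1 := one_sub_mem_slitPlane_of_norm_lt hx.1
    have n1 := Complex.slitPlane_ne_zero hx1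
    have p1 := ((hasDerivAt_id x).const_sub 1).cpow_const (c := C - A - B) hx1
    refine ⟨_, p1.mul (hypergeometric_hasDerivAt (C - A) (C - B) hC hx.1), ?_⟩
    simp only [hgEuler, id_eq]
    rw [cpow_sub_one_eq n1, show C + 1 - A - B = C - A - B + 1 by ring,
      cpow_add_one_eq n1, show C + 1 - A = C - A + 1 by ring,
      show C + 1 - B = C - B + 1 by ring]
    field_simp
    ring
  snd x hx := by
    have hx1 := one_sub_mem_slitPlane_of_norm_lt hx.1
    have n1 := Complex.slitPlane_ne_zero hx1
    have p1 := ((hasDerivAt_id x).const_sub 1).cpow_const (c := C - A - B + 1) hx1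
    have ode := hypergeometric_ode (C - A) (C - B) hC hx.1
    unfold hgEuler
    rw [show C + 1 - A - B = C - A - B + 1 by ring, show C + 1 - A = C - A + 1 by ring,
      show C + 1 - B = C - B + 1 by ring]
    refine ⟨_, p1.mul (hypergeometric_hasDerivAt (C - A + 1) (C - B + 1) hC.add_one hx.1), ?_⟩
    simp only [id_eq]
    rw [add_sub_cancel_right, cpow_add_one_eq n1]
    linear_combination (1 - x) ^ (C - A - B) * ode

lemma isHGPair_hgU (h : HGGeneric A B C) : IsHGPair A B C (hgU A B C) (hgU A B (C + 1)) := by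
  have hE : NonPole (A + B - C) := by simpa using h.nonPole_neg_exponent 0
  have hE0 := hE.ne_zero
  have hγ : NonPole (C - A - B) := by simpa using h.nonPole_exponent 0
  have hγ0 := hγ.ne_zero
  have hC0 := h.bot.ne_zero
  have hα := gaussValue_add_one h.bot hγ h.bot_left h.bot_right
  unfold hgU
  rw [show A + B - (C + 1) + 1 = A + B - C by ring]
  set α := gaussValue A B C
  set α' := gaussValue A B (C + 1)
  constructor
  · intro x hx
    have hd := hypergeometric_hasDerivAt A B hE.add_one hx.2
    have hi := mul_deriv_hypergeometric_add_one A B hE hx.2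
    refine ⟨_, (hd.comp_const_sub 1 x).const_mul α, ?_⟩
    have : (C - A) * (C - B) / C * (α' * ₂F₁ A B (A + B - C) (1 - x)) =
        (C - A - B) * α * ₂F₁ A B (A + B - C) (1 - x) := by
      field_simp
      linear_combination ₂F₁ A B (A + B - C) (1 - x) * hα
    rw [this]
    linear_combination -α * hi
  · intro x hx
    have hd := hypergeometric_hasDerivAt A B hE hx.2
    have hi := one_sub_mul_deriv_hypergeometric A B hE hx.2
    refine ⟨_, (hd.comp_const_sub 1 x).const_mul α', ?_⟩
    have e : C * α = - ((A + B - C - A) * (A + B - C - B) / (A + B - C) * α') := by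
      field_simp
      linear_combination hα
    rw [mul_sub, ← mul_assoc C α, e]
    linear_combination -α' * hi

lemma isHGPair_hgV (h : HGGeneric A B C) : IsHGPair A B C (hgV A B C) (hgV A B (C + 1)) := by
  have hE : A + B - (C + 1) ≠ 0 := by
    have := (h.nonPole_neg_exponent (-1)).ne_zero
    push_cast at this
    convert this using 1
    ring
  have hγ : NonPole (C - A - B + 1) := by simpa using h.nonPole_exponent 1
  have hγ0 := hγ.ne_zero
  have hC0 := h.bot.ne_zero
  have hβ : (C - A - B + 1) * (Complex.Gamma (C + 1) * Complex.Gamma (A + B - (C + 1)) /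
      (Complex.Gamma A * Complex.Gamma B)) =
      -C * (Complex.Gamma C * Complex.Gamma (A + B - C) /
        (Complex.Gamma A * Complex.Gamma B)) := by
    rw [show A + B - C = A + B - (C + 1) + 1 by ring, Complex.Gamma_add_one _ hC0,
      Complex.Gamma_add_one _ hE]
    ring
  unfold hgV
  set β := Complex.Gamma C * Complex.Gamma (A + B - C) / (Complex.Gamma A * Complex.Gamma B)
  set β' := Complex.Gamma (C + 1) * Complex.Gamma (A + B - (C + 1)) /
    (Complex.Gamma A * Complex.Gamma B)
  rw [show C + 1 - A - B = C - A - B + 1 by ring, show C + 1 - A = C - A + 1 by ring,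
      show C + 1 - B = C - B + 1 by ring]
  constructor
  · intro x hx
    have hx1 := one_sub_mem_slitPlane_of_norm_lt hx.1
    have n1 := Complex.slitPlane_ne_zero hx1
    have p1 := ((hasDerivAt_id x).const_sub 1).cpow_const (c := C - A - B) hx1
    have hd := (hypergeometric_hasDerivAt (C - A) (C - B) hγ hx.2).comp_const_sub 1 x
    refine ⟨_, (p1.mul hd).const_mul β, ?_⟩
    have e : β' / C = -β / (C - A - B + 1) := by
      field_simp
      linear_combination hβ
    rw [show (C - A) * (C - B) / C * (β' * ((1 - x) ^ (C - A - B + 1) *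
        ₂F₁ (C - A + 1) (C - B + 1) (C - A - B + 1 + 1) (1 - x))) =
        (C - A) * (C - B) * (β' / C) * ((1 - x) ^ (C - A - B + 1) *
        ₂F₁ (C - A + 1) (C - B + 1) (C - A - B + 1 + 1) (1 - x)) by ring, e,
      cpow_add_one_eq n1]
    simp only [id_eq]
    rw [cpow_sub_one_eq n1]
    field_simp
    ring
  · intro x hx
    have hx1 := one_sub_mem_slitPlane_of_norm_lt hx.1
    have n1 := Complex.slitPlane_ne_zero hx1
    have p1 := ((hasDerivAt_id x).const_sub 1).cpow_const (c := C - A - B + 1) hx1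
    have hd := (hypergeometric_hasDerivAt (C - A + 1) (C - B + 1) hγ.add_one
      hx.2).comp_const_sub 1 x
    have ode := hypergeometric_ode (C - A) (C - B) hγ hx.2
    refine ⟨_, (p1.mul hd).const_mul β', ?_⟩
    simp only [id_eq]
    rw [add_sub_cancel_right, cpow_add_one_eq n1]
    linear_combination -(1 - x) ^ (C - A - B) * β' * ode -
      (1 - x) ^ (C - A - B) * ₂F₁ (C - A) (C - B) (C - A - B + 1) (1 - x) * hβ

end pairs

/-! ### The connection formula for `₂F₁` between `0` and `1` -/

lemma continuousAt_hypergeometric_zero (A B C : ℂ) : ContinuousAt (₂F₁ A B C) (0 : ℂ) := by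
  have := ((subExp_hgCoeff A B C).hasDerivAt (x := 0) (by simp)).continuousAt
  simpa only [← hypergeometric_eq_tsum] using this

lemma tendsto_hypergeometric_zero (A B C : ℂ) :
    Tendsto (₂F₁ A B C) (𝓝[hgLens] (0 : ℂ)) (𝓝 1) := by
  have := (continuousAt_hypergeometric_zero A B C).tendsto
  rw [ordinaryHypergeometric_zero] at this
  exact this.mono_left nhdsWithin_le_nhds

lemma tendsto_one_sub_nhdsWithin_hgLens :
    Tendsto (fun x : ℂ => 1 - x) (𝓝[hgLens] 1) (𝓝 0) := by
  have : Tendsto (fun x : ℂ => 1 - x) (𝓝 1) (𝓝 (1 - 1)) :=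
    (continuous_const.sub continuous_id).tendsto 1
  rw [sub_self] at this
  exact this.mono_left nhdsWithin_le_nhds

lemma tendsto_hypergeometric_one_sub (A B C : ℂ) :
    Tendsto (fun x : ℂ => ₂F₁ A B C (1 - x)) (𝓝[hgLens] 1) (𝓝 1) := by
  have := (continuousAt_hypergeometric_zero A B C).tendsto
  rw [ordinaryHypergeometric_zero] at this
  exact this.comp tendsto_one_sub_nhdsWithin_hgLens

lemma tendsto_cpow_zero {s : ℂ} (hs : 0 < s.re) : Tendsto (fun x : ℂ => x ^ s) (𝓝 0) (𝓝 0) := by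
  have h := (Complex.continuousAt_cpow_zero_of_re_pos hs).tendsto
  rw [Complex.zero_cpow (by rintro rfl; simp at hs)] at h
  exact h.comp (tendsto_id.prodMk_nhds tendsto_const_nhds)

lemma tendsto_one_sub_cpow_zero (s : ℂ) :
    Tendsto (fun x : ℂ => (1 - x) ^ s) (𝓝[hgLens] 0) (𝓝 1) := by
  have : ContinuousAt (fun x : ℂ => (1 - x) ^ s) 0 :=
    (continuousAt_const.sub continuousAt_id).cpow continuousAt_const (by simp)
  have := this.tendsto
  simp only [sub_zero, Complex.one_cpow] at this
  exact this.mono_left nhdsWithin_le_nhds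

lemma tendsto_hgEuler_zero (A B C : ℂ) : Tendsto (hgEuler A B C) (𝓝[hgLens] 0) (𝓝 1) := by
  unfold hgEuler
  simpa using (tendsto_one_sub_cpow_zero (C - A - B)).mul
    (tendsto_hypergeometric_zero (C - A) (C - B) C)

/-- Euler's transformation for `0 < re C`: the second solution at `0` has exponent `1 - C`, so the
Wronskian of the two sides vanishes by its behaviour at `0`. -/
lemma hypergeometric_eq_hgEuler_of_re_pos {A B C : ℂ} (hC : 0 < C.re) :
    ∀ x ∈ hgLens, ₂F₁ A B C x = hgEuler A B C x := by
  have hC' : NonPole C := .of_re_pos hC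
  have H := isHGPair_hypergeometric (A := A) (B := B) hC'
  have H' := isHGPair_hgEuler (A := A) (B := B) hC'
  obtain ⟨κ, hκ⟩ := H.wronskian H'
  have hκ0 : κ = 0 := by
    have hl := (((tendsto_hypergeometric_zero A B C).mul (tendsto_hgEuler_zero A B (C + 1))).sub
      ((tendsto_hypergeometric_zero A B (C + 1)).mul (tendsto_hgEuler_zero A B C))).mul
      (((tendsto_cpow_zero hC).mono_left nhdsWithin_le_nhds).mul
        (tendsto_one_sub_cpow_zero (-(C - A - B))))
    rw [zero_mul, mul_zero] at hl
    refine tendsto_nhds_unique ?_ hl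
    refine tendsto_const_nhds.congr' ?_
    filter_upwards [self_mem_nhdsWithin] with x hx using (hκ x hx).symm
  have hw : ∀ x ∈ hgLens, ₂F₁ A B C x * hgEuler A B (C + 1) x -
      ₂F₁ A B (C + 1) x * hgEuler A B C x = 0 := by
    intro x hx
    have h := hκ x hx
    have n0 := Complex.slitPlane_ne_zero (mem_slitPlane_of_mem_hgLens hx)
    have n1 := Complex.slitPlane_ne_zero (one_sub_mem_slitPlane_of_norm_lt hx.1)
    rw [hκ0, mul_eq_zero] at h
    refine h.resolve_right (mul_ne_zero ?_ ?_)
    · simp [Complex.cpow_eq_zero_iff, n0]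
    · simp [Complex.cpow_eq_zero_iff, n1]
  obtain ⟨x₀, hx₀, h0⟩ := ((eventually_mem_nhdsWithin (s := hgLens) (a := 0)).and
    ((tendsto_hgEuler_zero A B C).eventually_ne one_ne_zero)).exists
  obtain ⟨c, hc⟩ := H.exists_eq_const_mul H' hw hx₀ h0
  have : c = 1 := by
    have h1 := (tendsto_hgEuler_zero A B C).const_mul c
    rw [mul_one] at h1
    refine tendsto_nhds_unique h1 ((tendsto_hypergeometric_zero A B C).congr' ?_)
    filter_upwards [self_mem_nhdsWithin] with x hx using hc x hx
  simpa [this] using hc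

/-- Euler's transformation `₂F₁ A B C x = (1 - x) ^ (C - A - B) * ₂F₁ (C - A) (C - B) C x`. -/
theorem hypergeometric_eq_hgEuler {A B C : ℂ} (hC : NonPole C) :
    ∀ x ∈ hgLens, ₂F₁ A B C x = hgEuler A B C x := by
  -- The second functions of the two pairs determine the first ones, so `C + 1` implies `C`.
  obtain ⟨N, hN⟩ := exists_nat_gt (-C.re)
  have hN : 0 < C.re + N := by linarith
  induction N generalizing C with
  | zero => exact hypergeometric_eq_hgEuler_of_re_pos (by simpa using hN)
  | succ N ih =>
    refine (isHGPair_hypergeometric hC).eqOn_fst hC.ne_zero (isHGPair_hgEuler hC)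
      (ih hC.add_one ?_ ?_)
    all_goals
      push_cast at hN
      simp only [Complex.add_re, Complex.one_re]
      linarith

section Gauss

/-- Terms of a convergent series majorizing `₂F₁ A B C 1` when `C` is large. -/
def gaussMajorant (n : ℕ) : ℝ := 6 / (((n : ℝ) + 2) * (n + 3))

lemma gaussMajorant_nonneg (n : ℕ) : 0 ≤ gaussMajorant n := by unfold gaussMajorant; positivity

lemma summable_gaussMajorant : Summable gaussMajorant := by
  have h : Summable fun n : ℕ => 6 * (1 / (((n + 2 : ℕ) : ℝ) ^ 2)) :=
    ((summable_nat_add_iff 2).2 (Real.summable_one_div_nat_pow.2 one_lt_two)).mul_left 6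
  refine h.of_nonneg_of_le gaussMajorant_nonneg fun n => ?_
  unfold gaussMajorant
  rw [mul_one_div]
  push_cast
  gcongr
  nlinarith [n.cast_nonneg (α := ℝ)]

/-- The parameter `C` is so large, in terms of the bound `p` for `‖A‖` and `‖B‖`, that the ratio of
consecutive coefficients of `₂F₁ A B C` is at most `(n + 1) / (n + 3)`. -/
structure GaussBound (p : ℝ) (A B C : ℂ) : Prop where
  nonneg : 0 ≤ p
  left : ‖A‖ ≤ p
  right : ‖B‖ ≤ p
  bot : 3 * p ^ 2 + 3 * p + 1 ≤ C.re

namespace GaussBound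

variable {p : ℝ} {A B C : ℂ}

lemma add_nat (h : GaussBound p A B C) (n : ℕ) : GaussBound p A B (C + n) :=
  ⟨h.nonneg, h.left, h.right, h.bot.trans (by simp)⟩

lemma add_one (h : GaussBound p A B C) : GaussBound p A B (C + 1) := by simpa using h.add_nat 1

lemma re_le (h : GaussBound p A B C) : A.re ≤ p ∧ B.re ≤ p :=
  ⟨(Complex.re_le_norm A).trans h.left, (Complex.re_le_norm B).trans h.right⟩

lemma re_pos (h : GaussBound p A B C) :
    0 < C.re ∧ 0 < (C - A).re ∧ 0 < (C - B).re ∧ 0 < (C - A - B).re := by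
  have h0 := h.nonneg
  have h1 := h.bot
  have h2 := h.re_le.1
  have h3 := h.re_le.2
  have h4 : 0 ≤ p ^ 2 := sq_nonneg p
  simp only [Complex.sub_re]
  refine ⟨?_, ?_, ?_, ?_⟩ <;> linarith

lemma norm_hgCoeff_le (h : GaussBound p A B C) (n : ℕ) :
    ‖hgCoeff A B C (n + 1)‖ ≤ p ^ 2 / ‖C‖ * gaussMajorant n := by
  have h0 := h.nonneg
  have hq : 0 < 3 * p ^ 2 + 3 * p + 1 := by positivity
  have hC : 0 < ‖C‖ := hq.trans_le (h.bot.trans (Complex.re_le_norm C))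
  induction n with
  | zero =>
    rw [hgCoeff_succ, hgCoeff_zero]
    norm_num [gaussMajorant]
    rw [div_mul_eq_mul_div, sq]
    gcongr
    exacts [h.left, h.right]
  | succ n ih =>
    have hCn : 3 * p ^ 2 + 3 * p + 1 + (n + 1 : ℝ) ≤ ‖C + ((n + 1 : ℕ) : ℂ)‖ := by
      refine le_trans ?_ (Complex.re_le_norm _)
      simp only [Complex.add_re, Complex.natCast_re]
      push_cast
      linarith [h.bot]
    have hn (z : ℂ) (hz : ‖z‖ ≤ p) : ‖z + ((n + 1 : ℕ) : ℂ)‖ ≤ p + (n + 1) := by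
      refine (norm_add_le _ _).trans (add_le_add hz ?_)
      rw [Complex.norm_natCast]; push_cast; rfl
    have h1 : ‖(1 : ℂ) + ((n + 1 : ℕ) : ℂ)‖ = n + 2 := by
      rw [← Nat.cast_one, ← Nat.cast_add, Complex.norm_natCast]; push_cast; ring
    rw [hgCoeff_succ, norm_mul, norm_mul, norm_div, norm_div, h1]
    calc _ ≤ (p + (n + 1)) / (3 * p ^ 2 + 3 * p + 1 + (n + 1 : ℝ)) * ((p + (n + 1)) / (n + 2)) *
          (p ^ 2 / ‖C‖ * gaussMajorant n) := by
          gcongr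
          · exact hn A h.left
          · exact hn B h.right
      _ ≤ ((n + 2 : ℝ) / (n + 4)) * (p ^ 2 / ‖C‖ * gaussMajorant n) := by
          have := gaussMajorant_nonneg n
          gcongr
          rw [div_mul_div_comm, div_le_div_iff₀ (by positivity) (by positivity)]
          have hn0 : (0 : ℝ) ≤ n := n.cast_nonneg
          have a1 : 0 ≤ p ^ 2 * n := by positivity
          have a2 : 0 ≤ p * n := by positivity
          have a3 : 0 ≤ p ^ 2 * n ^ 2 := by positivity
          have a4 : 0 ≤ p * n ^ 2 := by positivity
          nlinarith
      _ = _ := by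
          unfold gaussMajorant
          push_cast
          field_simp
          ring

lemma summable_norm_hgCoeff (h : GaussBound p A B C) : Summable fun n => ‖hgCoeff A B C n‖ := by
  rw [← summable_nat_add_iff 1]
  exact (summable_gaussMajorant.mul_left _).of_nonneg_of_le (fun _ => norm_nonneg _)
    h.norm_hgCoeff_le

lemma norm_tsum_sub_one_le (h : GaussBound p A B C) :
    ‖∑' n, hgCoeff A B C n - 1‖ ≤ p ^ 2 / ‖C‖ * ∑' n, gaussMajorant n := by
  rw [h.summable_norm_hgCoeff.of_norm.tsum_eq_zero_add, hgCoeff_zero, add_sub_cancel_left,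
    ← tsum_mul_left]
  exact tsum_of_norm_bounded (summable_gaussMajorant.mul_left _).hasSum h.norm_hgCoeff_le

lemma tendsto_natCast_mul_hgCoeff (h : GaussBound p A B C) :
    Tendsto (fun n : ℕ => n * hgCoeff A B C n) atTop (𝓝 0) := by
  rw [← tendsto_add_atTop_iff_nat 1]
  refine squeeze_zero_norm (a := fun n : ℕ => p ^ 2 / ‖C‖ * (6 * (1 / ((n : ℝ) + 1))))
    (fun n => ?_) ?_
  · rw [norm_mul, Complex.norm_natCast]
    calc ((n + 1 : ℕ) : ℝ) * ‖hgCoeff A B C (n + 1)‖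
        ≤ ((n + 1 : ℕ) : ℝ) * (p ^ 2 / ‖C‖ * gaussMajorant n) := by
          gcongr; exact h.norm_hgCoeff_le n
      _ = p ^ 2 / ‖C‖ * (((n + 1 : ℕ) : ℝ) * gaussMajorant n) := by ring
      _ ≤ _ := by
        have : 0 ≤ p ^ 2 / ‖C‖ := by positivity
        refine mul_le_mul_of_nonneg_left ?_ this
        unfold gaussMajorant
        push_cast
        rw [mul_one_div, mul_div_assoc', div_le_div_iff₀ (by positivity) (by positivity)]
        nlinarith [n.cast_nonneg (α := ℝ)]
  · simpa using (tendsto_one_div_add_atTop_nhds_zero_nat.const_mul (6 : ℝ)).const_mul (p ^ 2 / ‖C‖)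

/-- The recursion in `C` for the value of `₂F₁ A B C` at `1`. -/
lemma tsum_add_one (h : GaussBound p A B C) :
    (C - A) * (C - B) / C * ∑' n, hgCoeff A B (C + 1) n =
      (C - A - B) * ∑' n, hgCoeff A B C n := by
  have hC : NonPole C := .of_re_pos h.re_pos.1
  have hs := ((h.add_one.summable_norm_hgCoeff.of_norm.hasSum.mul_left
    ((C - A) * (C - B) / C)).sub (h.summable_norm_hgCoeff.of_norm.hasSum.mul_left (C - A - B)))
  rw [← sub_eq_zero]
  refine tendsto_nhds_unique hs.tendsto_sum_nat ?_
  convert h.tendsto_natCast_mul_hgCoeff using 2 with n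
  have := Finset.sum_range_sub (fun n : ℕ => n * hgCoeff A B C n) n
  rw [Nat.cast_zero, zero_mul, sub_zero] at this
  rw [← this]
  refine Finset.sum_congr rfl fun n _ => ?_
  rw [← hgCoeff_telescope A B hC]
  push_cast
  ring

end GaussBound

lemma Gamma_add_natCast {z : ℂ} (hz : NonPole z) (n : ℕ) :
    Complex.Gamma (z + n) = Complex.Gamma z * (ascPochhammer ℂ n).eval z := by
  induction n with
  | zero => simp
  | succ n ih =>
    push_cast
    rw [← add_assoc, Complex.Gamma_add_one _ (hz.add_natCast_ne n), ih, ascPochhammer_succ_eval]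
    ring

lemma Gamma_mul_GammaSeq {z : ℂ} (hz : NonPole z) (n : ℕ) :
    Complex.Gamma (z + (n + 1 : ℕ)) * Complex.GammaSeq z n =
      Complex.Gamma z * ((n : ℂ) ^ z * n !) := by
  have hne := hz.poch_ne_zero (n + 1)
  have : ∏ j ∈ Finset.range (n + 1), (z + j) = (ascPochhammer ℂ (n + 1)).eval z := by
    induction n + 1 with
    | zero => simp
    | succ n ih => rw [Finset.prod_range_succ, ih, ascPochhammer_succ_eval]
  rw [Gamma_add_natCast hz, Complex.GammaSeq, this]
  field_simp

/-- By Euler's limit formula for `Γ`, quotients of Gamma values at `z + n` behave as powers of `n`,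
and the exponents cancel here. -/
lemma tendsto_gaussValue_add_natCast {A B C : ℂ} (hC : NonPole C) (hγ : NonPole (C - A - B))
    (hA : NonPole (C - A)) (hB : NonPole (C - B)) :
    Tendsto (fun n : ℕ => gaussValue A B (C + n)) atTop (𝓝 1) := by
  rw [← tendsto_add_atTop_iff_nat 1]
  have g1 := hC.Gamma_ne_zero
  have g2 := hγ.Gamma_ne_zero
  have g3 := hA.Gamma_ne_zero
  have g4 := hB.Gamma_ne_zero
  have hl := (((Complex.GammaSeq_tendsto_Gamma (C - A)).mul
    (Complex.GammaSeq_tendsto_Gamma (C - B))).div ((Complex.GammaSeq_tendsto_Gamma C).mul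
    (Complex.GammaSeq_tendsto_Gamma (C - A - B))) (mul_ne_zero g1 g2)).const_mul
    (gaussValue A B C)
  have h1 : gaussValue A B C * (Complex.Gamma (C - A) * Complex.Gamma (C - B) /
      (Complex.Gamma C * Complex.Gamma (C - A - B))) = 1 := by
    unfold gaussValue
    field_simp
  rw [h1] at hl
  refine hl.congr' ?_
  filter_upwards [eventually_ne_atTop 0] with n hn
  have hn0 : (n : ℂ) ≠ 0 := by exact_mod_cast hn
  have hs {z : ℂ} (hz : NonPole z) : Complex.GammaSeq z n ≠ 0 := by
    intro h
    have := Gamma_mul_GammaSeq hz n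
    rw [h, mul_zero, eq_comm] at this
    simp [hz.Gamma_ne_zero, hn0, Nat.factorial_ne_zero, Complex.cpow_eq_zero_iff] at this
  have e {z : ℂ} (hz : NonPole z) : Complex.Gamma (z + (n + 1 : ℕ)) =
      Complex.Gamma z * ((n : ℂ) ^ z * n !) / Complex.GammaSeq z n := by
    rw [← Gamma_mul_GammaSeq hz, mul_div_cancel_right₀ _ (hs hz)]
  have s1 := hs hC
  have s2 := hs hγ
  have s3 := hs hA
  have s4 := hs hB
  have hf : (n ! : ℂ) ≠ 0 := by exact_mod_cast n.factorial_ne_zero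
  have pw (z : ℂ) : (n : ℂ) ^ z ≠ 0 := by simp [Complex.cpow_eq_zero_iff, hn0]
  have hp : (n : ℂ) ^ C * (n : ℂ) ^ (C - A - B) = (n : ℂ) ^ (C - A) * (n : ℂ) ^ (C - B) := by
    rw [← Complex.cpow_add _ _ hn0, ← Complex.cpow_add _ _ hn0]
    congr 1
    ring
  unfold gaussValue
  rw [show C + ((n + 1 : ℕ) : ℂ) - A - B = C - A - B + ((n + 1 : ℕ) : ℂ) by ring,
    show C + ((n + 1 : ℕ) : ℂ) - A = C - A + ((n + 1 : ℕ) : ℂ) by ring,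
    show C + ((n + 1 : ℕ) : ℂ) - B = C - B + ((n + 1 : ℕ) : ℂ) by ring, e hC, e hγ, e hA, e hB]
  have p3 := pw (C - A)
  have p4 := pw (C - B)
  simp only [Pi.div_apply]
  field_simp
  linear_combination -hp

/-- Gauss' summation theorem, for `C` large: the quotient of the two sides is invariant under
`C ↦ C + 1`, and both sides tend to `1` along `C + n`. -/
theorem GaussBound.tsum_hgCoeff {p : ℝ} {A B C : ℂ} (h : GaussBound p A B C) :
    ∑' n, hgCoeff A B C n = gaussValue A B C := by
  have hnp (n : ℕ) : NonPole (C + n) ∧ NonPole (C + n - A) ∧ NonPole (C + n - B) ∧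
      NonPole (C + n - A - B) := by
    obtain ⟨h1, h2, h3, h4⟩ := (h.add_nat n).re_pos
    exact ⟨.of_re_pos h1, .of_re_pos h2, .of_re_pos h3, .of_re_pos h4⟩
  have hne (n : ℕ) : gaussValue A B (C + n) ≠ 0 := by
    obtain ⟨h1, h2, h3, h4⟩ := hnp n
    exact div_ne_zero (mul_ne_zero h1.Gamma_ne_zero h4.Gamma_ne_zero)
      (mul_ne_zero h2.Gamma_ne_zero h3.Gamma_ne_zero)
  have hconst (n : ℕ) : (∑' k, hgCoeff A B (C + n) k) / gaussValue A B (C + n) =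
      (∑' k, hgCoeff A B C k) / gaussValue A B C := by
    induction n with
    | zero => simp
    | succ n ih =>
      obtain ⟨h1, h2, h3, h4⟩ := hnp n
      rw [← ih]
      have e1 := (h.add_nat n).tsum_add_one
      have e2 := gaussValue_add_one h1 h4 h2 h3
      have n1 := hne n
      have n2 := hne (n + 1)
      push_cast at n2 ⊢
      rw [← add_assoc] at n2 ⊢
      have z1 := h1.ne_zero
      have z2 := h2.ne_zero
      have z3 := h3.ne_zero
      have z4 := h4.ne_zero
      rw [div_eq_div_iff n2 n1]
      rw [div_mul_eq_mul_div, div_eq_iff z1] at e1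
      apply mul_left_cancel₀ (mul_ne_zero z2 z3)
      linear_combination gaussValue A B (C + n) * e1 - (∑' k, hgCoeff A B (C + n) k) * e2
  obtain ⟨h1, h2, h3, h4⟩ := hnp 0
  simp only [Nat.cast_zero, add_zero] at h1 h2 h3 h4
  have l1 : Tendsto (fun n : ℕ => ∑' k, hgCoeff A B (C + n) k) atTop (𝓝 1) := by
    rw [tendsto_iff_norm_sub_tendsto_zero]
    refine squeeze_zero (fun _ => norm_nonneg _) (fun n => (h.add_nat n).norm_tsum_sub_one_le) ?_
    have : Tendsto (fun n : ℕ => ‖C + n‖) atTop atTop := by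
      refine tendsto_atTop_mono (fun n => ?_) tendsto_natCast_atTop_atTop
      refine le_trans ?_ (Complex.re_le_norm _)
      simp [h.re_pos.1.le]
    simpa using (this.const_div_atTop (p ^ 2)).mul_const (∑' n, gaussMajorant n)
  have l2 := l1.div (tendsto_gaussValue_add_natCast h1 h4 h2 h3) one_ne_zero
  have l3 := tendsto_nhds_unique (l2.congr hconst) tendsto_const_nhds
  have n0 := hne 0
  simp only [Nat.cast_zero, add_zero] at n0
  rw [div_one, eq_comm, div_eq_one_iff_eq n0] at l3
  exact l3

lemma GaussBound.tendsto_hypergeometric {p : ℝ} {A B C : ℂ} (h : GaussBound p A B C) :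
    Tendsto (₂F₁ A B C) (𝓝[hgLens] 1) (𝓝 (gaussValue A B C)) := by
  have hc : ContinuousOn (fun x : ℂ => ∑' n, hgCoeff A B C n * x ^ n) (Metric.closedBall 0 1) := by
    refine continuousOn_tsum (u := fun n => ‖hgCoeff A B C n‖)
      (fun n => (continuous_const.mul (continuous_pow n)).continuousOn) h.summable_norm_hgCoeff
      fun n x hx => ?_
    rw [norm_mul, norm_pow]
    exact mul_le_of_le_one_right (norm_nonneg _)
      (pow_le_one₀ (norm_nonneg _) (mem_closedBall_zero_iff.1 hx))
  have := (hc 1 (by simp)).tendsto.mono_left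
    (nhdsWithin_mono 1 fun x (hx : x ∈ hgLens) => mem_closedBall_zero_iff.2 hx.1.le)
  simp only [one_pow, mul_one, h.tsum_hgCoeff] at this
  simpa only [← hypergeometric_eq_tsum] using this

end Gauss

section Connection

variable {A B C : ℂ}

lemma tendsto_hgU (A B C : ℂ) :
    Tendsto (hgU A B C) (𝓝[hgLens] 1) (𝓝 (gaussValue A B C)) := by
  unfold hgU
  simpa using (tendsto_hypergeometric_one_sub A B (A + B - C + 1)).const_mul (gaussValue A B C)

lemma tendsto_hgV (h : 0 < (C - A - B).re) : Tendsto (hgV A B C) (𝓝[hgLens] 1) (𝓝 0) := by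
  unfold hgV
  simpa using (((tendsto_cpow_zero h).comp tendsto_one_sub_nhdsWithin_hgLens).mul
    (tendsto_hypergeometric_one_sub (C - A) (C - B) (C - A - B + 1))).const_mul
    (Complex.Gamma C * Complex.Gamma (A + B - C) / (Complex.Gamma A * Complex.Gamma B))

/-- A form of the connection formula with one unknown coefficient, for `C` large: the Wronskian of
`₂F₁ A B C - hgU A B C` and `hgV A B C` vanishes by its behaviour at `1`. -/
lemma HGGeneric.exists_eq_hgU_add_of_gaussBound (h : HGGeneric A B C) {p : ℝ}
    (hp : GaussBound p A B C) :
    ∃ κ, ∀ x ∈ hgLens, ₂F₁ A B C x = hgU A B C x + κ * hgV A B C x := by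
  have H := (isHGPair_hypergeometric (A := A) (B := B) h.bot).sub (isHGPair_hgU h)
  have H' := isHGPair_hgV h
  have hE : NonPole (A + B - C) := by simpa using h.nonPole_neg_exponent 0
  set β := Complex.Gamma C * Complex.Gamma (A + B - C) / (Complex.Gamma A * Complex.Gamma B) with hβ
  have hβ0 : β ≠ 0 := div_ne_zero (mul_ne_zero h.bot.Gamma_ne_zero hE.Gamma_ne_zero)
    (mul_ne_zero h.left.Gamma_ne_zero h.right.Gamma_ne_zero)
  obtain ⟨κ, hκ⟩ := H.wronskian H'
  have d0 : Tendsto (fun x => ₂F₁ A B C x - hgU A B C x) (𝓝[hgLens] 1) (𝓝 0) := by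
    simpa using hp.tendsto_hypergeometric.sub (tendsto_hgU A B C)
  have d1 : Tendsto (fun x => ₂F₁ A B (C + 1) x - hgU A B (C + 1) x) (𝓝[hgLens] 1) (𝓝 0) := by
    simpa using hp.add_one.tendsto_hypergeometric.sub (tendsto_hgU A B (C + 1))
  have pw {x : ℂ} (hx : x ≠ 0) (s : ℂ) : x ^ s ≠ 0 := by simp [Complex.cpow_eq_zero_iff, hx]
  have hκ0 : κ = 0 := by
    -- Both differences of first entries tend to `0` at `1`, while the entries of the other pair
    -- stay bounded after division by `(1 - x) ^ (C - A - B)`.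
    have v0 := (tendsto_hypergeometric_one_sub (C - A) (C - B) (C - A - B + 1)).const_mul β
    have v1 := (tendsto_one_sub_nhdsWithin_hgLens.mul
      (tendsto_hypergeometric_one_sub (C + 1 - A) (C + 1 - B) (C - A - B + 1 + 1))).const_mul
      (Complex.Gamma (C + 1) * Complex.Gamma (A + B - (C + 1)) /
        (Complex.Gamma A * Complex.Gamma B))
    have xc : Tendsto (fun x : ℂ => x ^ C) (𝓝[hgLens] 1) (𝓝 (1 ^ C)) :=
      ((continuousAt_id.cpow continuousAt_const (by simp)).tendsto).mono_left nhdsWithin_le_nhds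
    have hl := ((d0.mul v1).sub (d1.mul v0)).mul xc
    simp only [zero_mul, sub_zero] at hl
    refine tendsto_nhds_unique ?_ hl
    refine tendsto_const_nhds.congr' ?_
    filter_upwards [self_mem_nhdsWithin] with x hx
    rw [← hκ x hx]
    have n1 := Complex.slitPlane_ne_zero (one_sub_mem_slitPlane_of_norm_lt hx.1)
    have p1 := pw n1 (C - A - B)
    unfold hgV
    rw [← hβ, show C + 1 - A - B = C - A - B + 1 by ring, cpow_add_one_eq n1, Complex.cpow_neg]
    field_simp
  have hw : ∀ x ∈ hgLens, (₂F₁ A B C x - hgU A B C x) * hgV A B (C + 1) x -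
      (₂F₁ A B (C + 1) x - hgU A B (C + 1) x) * hgV A B C x = 0 := by
    intro x hx
    have h := hκ x hx
    have n0 := Complex.slitPlane_ne_zero (mem_slitPlane_of_mem_hgLens hx)
    have n1 := Complex.slitPlane_ne_zero (one_sub_mem_slitPlane_of_norm_lt hx.1)
    rw [hκ0, mul_eq_zero] at h
    exact h.resolve_right (mul_ne_zero (pw n0 _) (pw n1 _))
  obtain ⟨x₀, hx₀, h0⟩ := ((eventually_mem_nhdsWithin (s := hgLens) (a := 1)).and
    ((tendsto_hypergeometric_one_sub (C - A) (C - B) (C - A - B + 1)).eventually_ne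
      one_ne_zero)).exists
  have n1 := Complex.slitPlane_ne_zero (one_sub_mem_slitPlane_of_norm_lt hx₀.1)
  obtain ⟨c, hc⟩ := H.exists_eq_const_mul H' hw hx₀ (mul_ne_zero hβ0 (mul_ne_zero (pw n1 _) h0))
  exact ⟨c, fun x hx => by linear_combination hc x hx⟩

/-- If the connection formula holds at `C + 1`, it holds at `C`. -/
lemma HGGeneric.eq_of_add_one (h : HGGeneric A B C) {κ : ℂ}
    (h1 : ∀ x ∈ hgLens, ₂F₁ A B (C + 1) x = hgU A B (C + 1) x + κ * hgV A B (C + 1) x) :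
    ∀ x ∈ hgLens, ₂F₁ A B C x = hgU A B C x + κ * hgV A B C x :=
  (isHGPair_hypergeometric h.bot).eqOn_fst h.bot.ne_zero
    ((isHGPair_hgU h).add ((isHGPair_hgV h).const_mul κ)) h1

/-- To prove a connection formula it suffices to treat large `C`. -/
lemma HGGeneric.induction_bot {P : ℂ → Prop} (h : HGGeneric A B C)
    (step : ∀ C, HGGeneric A B C → P (C + 1) → P C)
    (large : ∀ C p, HGGeneric A B C → GaussBound p A B C → P C) : P C := by
  set p := max ‖A‖ ‖B‖ with hp
  obtain ⟨N, hN⟩ := exists_nat_gt (3 * p ^ 2 + 3 * p + 1 - C.re)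
  have hN : 3 * p ^ 2 + 3 * p + 1 ≤ C.re + N := by linarith
  induction N generalizing C with
  | zero =>
    exact large C p h ⟨(norm_nonneg A).trans (le_max_left _ _), le_max_left _ _, le_max_right _ _,
      by simpa using hN⟩
  | succ N ih =>
    refine step C h (ih h.add_one ?_ ?_)
    all_goals
      push_cast at *
      simp only [Complex.add_re, Complex.one_re]
      linarith

lemma HGGeneric.exists_eq_hgU_add (h : HGGeneric A B C) :
    ∃ κ, ∀ x ∈ hgLens, ₂F₁ A B C x = hgU A B C x + κ * hgV A B C x :=
  h.induction_bot (P := fun C => ∃ κ, ∀ x ∈ hgLens, ₂F₁ A B C x = hgU A B C x + κ * hgV A B C x)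
    (fun _ h ⟨κ, hκ⟩ => ⟨κ, h.eq_of_add_one hκ⟩)
    (fun _ _ h hp => h.exists_eq_hgU_add_of_gaussBound hp)

/-- The connection formula for `C` large. Euler's transformation exchanges the two solutions at `1`,
so that the formula with one unknown coefficient, for the parameters `C - A`, `C - B`, `C`, gives
the coefficient of `hgV A B C`. The other coefficient is the limit at `1`. -/
lemma HGGeneric.eq_hgU_add_hgV_of_gaussBound (h : HGGeneric A B C) {p : ℝ}
    (hp : GaussBound p A B C) : ∀ x ∈ hgLens, ₂F₁ A B C x = hgU A B C x + hgV A B C x := by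
  obtain ⟨κ, hκ⟩ := h.euler.exists_eq_hgU_add
  set c := κ * (Complex.Gamma C * Complex.Gamma (C - A + (C - B) - C) /
    (Complex.Gamma (C - A) * Complex.Gamma (C - B))) with hc
  have key : ∀ x ∈ hgLens,
      ₂F₁ A B C x = hgV A B C x + c * ₂F₁ A B (A + B - C + 1) (1 - x) := by
    intro x hx
    have n1 := Complex.slitPlane_ne_zero (one_sub_mem_slitPlane_of_norm_lt hx.1)
    have p1 : (1 - x) ^ (C - A - B) ≠ 0 := by simp [Complex.cpow_eq_zero_iff, n1]
    rw [hypergeometric_eq_hgEuler h.bot x hx, hgEuler, hκ x hx, hc]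
    unfold hgU hgV gaussValue
    rw [sub_sub_cancel, sub_sub_cancel, show A - (C - B) = -(C - A - B) by ring,
      Complex.cpow_neg, show -(C - A - B) + 1 = A + B - C + 1 by ring,
      show -(C - A - B) = A + B - C by ring,
      show C - A + (C - B) - C + 1 = C - A - B + 1 by ring]
    field_simp
  have hcα : c = gaussValue A B C := by
    have l := (tendsto_hgV hp.re_pos.2.2.2).add
      ((tendsto_hypergeometric_one_sub A B (A + B - C + 1)).const_mul c)
    rw [zero_add, mul_one] at l
    refine tendsto_nhds_unique l (hp.tendsto_hypergeometric.congr' ?_)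
    filter_upwards [self_mem_nhdsWithin] with x hx using key x hx
  intro x hx
  rw [key x hx, hcα, hgU, add_comm]

/-- The connection formula for `₂F₁` between the singular points `0` and `1`. -/
theorem HGGeneric.eq_hgU_add_hgV (h : HGGeneric A B C) :
    ∀ x ∈ hgLens, ₂F₁ A B C x = hgU A B C x + hgV A B C x :=
  h.induction_bot (P := fun C => ∀ x ∈ hgLens, ₂F₁ A B C x = hgU A B C x + hgV A B C x)
    (fun _ h h1 => by simpa using h.eq_of_add_one (κ := 1) (by simpa using h1))
    (fun _ _ h hp => h.eq_hgU_add_hgV_of_gaussBound hp)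

end Connection

/-! ### Convergence of double series of Horn type -/

section Pochhammer

lemma poch_natCast (z : ℂ) (k : ℕ) : poch z k = (ascPochhammer ℂ k).eval z := rfl

lemma poch_neg_natCast (z : ℂ) (k : ℕ) :
    poch z (-(k : ℤ)) = ((ascPochhammer ℂ k).eval (z - k))⁻¹ := by
  cases k with
  | zero => simp [show poch z 0 = _ from poch_natCast z 0]
  | succ k => rfl

lemma nonPole_sub_nat {z : ℂ} (hz : ∀ k : ℤ, z ≠ k) (n : ℕ) : NonPole (z - n) :=
  .of_not_int fun k hk => hz (k + n) (by push_cast; linear_combination hk)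

lemma Gamma_mul_poch_neg {z : ℂ} (hz : ∀ k : ℤ, z ≠ k) (n : ℕ) :
    Complex.Gamma z * poch z (-(n : ℤ)) = Complex.Gamma (z - n) := by
  have h := Gamma_add_natCast (nonPole_sub_nat hz n) n
  rw [sub_add_cancel] at h
  have := (nonPole_sub_nat hz n).poch_ne_zero n
  rw [poch_neg_natCast, h]
  field_simp

lemma poch_neg_ne_zero {z : ℂ} (hz : ∀ k : ℤ, z ≠ k) (n : ℕ) : poch z (-(n : ℤ)) ≠ 0 := by
  rw [poch_neg_natCast]
  exact inv_ne_zero ((nonPole_sub_nat hz n).poch_ne_zero n)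

lemma Gamma_mul_poch_sub {z : ℂ} (hz : ∀ k : ℤ, z ≠ k) (m n : ℕ) :
    Complex.Gamma z * poch z ((m : ℤ) - n) = Complex.Gamma (z - n + m) := by
  rcases le_total n m with h | h
  · obtain ⟨k, rfl⟩ := Nat.exists_eq_add_of_le h
    rw [show ((n + k : ℕ) : ℤ) - n = (k : ℕ) by push_cast; ring, poch_natCast,
      ← Gamma_add_natCast (NonPole.of_not_int hz)]
    congr 1
    push_cast
    ring
  · obtain ⟨k, rfl⟩ := Nat.exists_eq_add_of_le h
    rw [show (m : ℤ) - ((m + k : ℕ) : ℤ) = -(k : ℕ) by push_cast; ring, Gamma_mul_poch_neg hz]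
    congr 1
    push_cast
    ring

lemma poch_sub {z : ℂ} (hz : ∀ k : ℤ, z ≠ k) (m n : ℕ) :
    poch z ((m : ℤ) - n) = poch z (-(n : ℤ)) * (ascPochhammer ℂ m).eval (z - n) := by
  apply mul_left_cancel₀ (NonPole.of_not_int hz).Gamma_ne_zero
  rw [Gamma_mul_poch_sub hz, ← mul_assoc, Gamma_mul_poch_neg hz,
    Gamma_add_natCast (nonPole_sub_nat hz n)]

lemma poch_add {z : ℂ} (hz : NonPole z) (m n : ℕ) :
    poch z ((m : ℤ) + n) = poch z n * (ascPochhammer ℂ m).eval (z + n) := by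
  apply mul_left_cancel₀ hz.Gamma_ne_zero
  rw [← Nat.cast_add, poch_natCast, poch_natCast, ← mul_assoc, ← Gamma_add_natCast hz,
    ← Gamma_add_natCast hz, ← Gamma_add_natCast (hz.add_nat n)]
  congr 1
  push_cast
  ring

/-- Reflection: `(z)_{-n} (1 - z)_n = (-1) ^ n`. -/
lemma poch_neg_mul_poch_one_sub {z : ℂ} (hz : ∀ k : ℤ, z ≠ k) (n : ℕ) :
    poch z (-(n : ℤ)) * poch (1 - z) n = (-1) ^ n := by
  have h := ascPochhammer_eval_neg_eq_descPochhammer ℂ ((n : ℂ) - z) n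
  rw [descPochhammer_eval_eq_ascPochhammer, neg_sub,
    show (n : ℂ) - z - n + 1 = 1 - z by ring] at h
  have hne := (nonPole_sub_nat hz n).poch_ne_zero n
  have h2 : ((-1 : ℂ) ^ n) * (-1) ^ n = 1 := by rw [← mul_pow]; simp
  rw [poch_neg_natCast, poch_natCast, inv_mul_eq_iff_eq_mul₀ hne, h, mul_right_comm, h2, one_mul]

lemma subExp_poch_div_factorial (z : ℂ) : SubExp fun n => poch z n / n ! := by
  refine .of_ratio (r := fun n => (z + n) / (1 + n)) (fun n => ?_)
    (by simpa using (tendsto_add_natCast_div z 1).norm)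
  rw [poch_natCast, poch_natCast, ascPochhammer_succ_eval, Nat.factorial_succ]
  push_cast
  rw [div_mul_div_comm]
  ring_nf

lemma subExp_factorial_div_poch (z : ℂ) : SubExp fun n => (n ! : ℂ) / poch z n := by
  refine .of_ratio (r := fun n => (1 + n) / (z + n)) (fun n => ?_)
    (by simpa using (tendsto_add_natCast_div 1 z).norm)
  rw [poch_natCast, poch_natCast, ascPochhammer_succ_eval, Nat.factorial_succ]
  push_cast
  rw [div_mul_div_comm]
  ring_nf

lemma subExp_factorial_mul_poch_neg (z : ℂ) : SubExp fun n => (n ! : ℂ) * poch z (-(n : ℤ)) := by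
  refine .of_ratio (r := fun n => -((1 + n) / (1 - z + n))) (fun n => ?_)
    (by simpa using (tendsto_add_natCast_div 1 (1 - z)).norm)
  rw [poch_neg_natCast, poch_neg_natCast, ascPochhammer_succ_left, Nat.factorial_succ]
  simp only [Polynomial.eval_mul, Polynomial.eval_X, Polynomial.eval_comp, Polynomial.eval_add,
    Polynomial.eval_one]
  push_cast
  rw [show z - (n + 1) + 1 = z - n by ring, mul_inv, ← neg_div_neg_eq (1 + (n : ℂ)) (1 - z + n),
    show -(1 - z + n) = z - (n + 1) by ring, div_eq_mul_inv]
  ring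

end Pochhammer

section Convergence

/-- The region of convergence, in terms of the absolute values of the variables. -/
def absRegion : Set (ℝ × ℝ) := {q | 2 * √(q.1 * q.2) + q.2 < 1 ∧ q.1 < 1 ∧ q.2 < 1}

lemma isOpen_absRegion : IsOpen absRegion := by
  refine IsOpen.and ?_ (IsOpen.and ?_ ?_)
  · exact isOpen_lt (by fun_prop) continuous_const
  · exact isOpen_lt continuous_fst continuous_const
  · exact isOpen_lt continuous_snd continuous_const

lemma four_mul_lt_of_mem_absRegion {X Y : ℝ} (hX : 0 ≤ X) (hY : 0 ≤ Y) (h : (X, Y) ∈ absRegion) :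
    4 * (X * Y) < (1 - Y) ^ 2 := by
  have h1 : 2 * √(X * Y) < 1 - Y := by linarith [h.1]
  have := pow_lt_pow_left₀ h1 (by positivity) two_ne_zero
  rw [mul_pow, Real.sq_sqrt (by positivity)] at this
  linarith

/-- The size of `(A)_{m-n} (B)_{m+n} / (m! (D)_m)` up to factors of subexponential growth. -/
def hornMajorant (p : ℕ × ℕ) : ℝ :=
  (p.1 + p.2)! * (if p.2 ≤ p.1 then ((p.1 - p.2)! : ℝ) else ((p.2 - p.1)! : ℝ)⁻¹) / (p.1 ! : ℝ) ^ 2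

lemma hornMajorant_nonneg (p : ℕ × ℕ) : 0 ≤ hornMajorant p := by
  unfold hornMajorant
  split_ifs <;> positivity

lemma factorial_two_mul_le (n : ℕ) : (2 * n)! ≤ 4 ^ n * n ! ^ 2 := by
  have h := Nat.choose_mul_factorial_mul_factorial (show n ≤ 2 * n by omega)
  rw [show 2 * n - n = n by omega] at h
  rw [← h, mul_assoc, ← sq]
  gcongr
  refine (Nat.choose_le_two_pow _ _).trans_eq ?_
  rw [pow_mul]
  norm_num

lemma factorial_mul_factorial_le (n j : ℕ) : (2 * n + j)! * j ! ≤ 4 ^ n * (n + j)! ^ 2 := by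
  induction j with
  | zero => simpa using factorial_two_mul_le n
  | succ j ih =>
    rw [← add_assoc, ← add_assoc, Nat.factorial_succ, Nat.factorial_succ, Nat.factorial_succ]
    calc (2 * n + j + 1) * (2 * n + j)! * ((j + 1) * j !)
        = ((2 * n + j + 1) * (j + 1)) * ((2 * n + j)! * j !) := by ring
      _ ≤ (n + j + 1) ^ 2 * (4 ^ n * (n + j)! ^ 2) := by
        gcongr
        nlinarith [sq_nonneg n]
      _ = _ := by ring

/-- The majorant decreases in `m ≥ n`, from its value at `m = n`. -/
lemma hornMajorant_le_left (n j : ℕ) : hornMajorant (n + j, n) ≤ 4 ^ n := by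
  have h := factorial_mul_factorial_le n j
  unfold hornMajorant
  rw [if_pos (by simp), div_le_iff₀ (by positivity)]
  simp only [add_tsub_cancel_left]
  rw [show n + j + n = 2 * n + j by ring]
  exact_mod_cast h

lemma hornMajorant_le_right (m j : ℕ) :
    hornMajorant (m, m + j) ≤ (j + 2 * m).choose (2 * m) * 4 ^ m := by
  have h := factorial_two_mul_le m
  have h2 := Nat.choose_mul_factorial_mul_factorial (show 2 * m ≤ j + 2 * m by omega)
  rw [Nat.add_sub_cancel] at h2
  have e : (if m + j ≤ m then ((m - (m + j))! : ℝ) else ((m + j - m)! : ℝ)⁻¹) = (j ! : ℝ)⁻¹ := by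
    rcases Nat.eq_zero_or_pos j with rfl | hj
    · simp
    · rw [if_neg (by omega), Nat.add_sub_cancel_left]
  unfold hornMajorant
  simp only
  rw [e, show m + (m + j) = j + 2 * m by ring, ← h2, div_le_iff₀ (by positivity)]
  push_cast
  have hj : (j ! : ℝ) ≠ 0 := by positivity
  rw [mul_inv_cancel_right₀ hj, mul_assoc]
  gcongr
  exact_mod_cast h

/-- The part `n ≤ m` is dominated by a product of two geometric series. The part `m ≤ n` is
dominated by binomial series in `Y`, whose sums form a geometric series of ratio
`4 X Y / (1 - Y) ^ 2`. -/
lemma summable_hornMajorant {X Y : ℝ} (hX : 0 ≤ X) (hY : 0 ≤ Y) (h : (X, Y) ∈ absRegion) :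
    Summable fun p : ℕ × ℕ => hornMajorant p * X ^ p.1 * Y ^ p.2 := by
  have h4 := four_mul_lt_of_mem_absRegion hX hY h
  obtain ⟨-, hX1, hY1⟩ := h
  simp only at hX1 hY1
  have hY0 : 0 < 1 - Y := by linarith
  have hXY : 0 ≤ 4 * (X * Y) := by positivity
  have g1 : Summable fun p : ℕ × ℕ => X ^ p.1 * (4 * (X * Y)) ^ p.2 :=
    (summable_geometric_of_lt_one hX hX1).mul_of_nonneg
      (summable_geometric_of_lt_one hXY (by nlinarith)) (fun _ => by positivity)
      fun _ => by positivity
  have g2 : Summable fun p : ℕ × ℕ =>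
      (4 * (X * Y)) ^ p.1 * ((p.2 + 2 * p.1).choose (2 * p.1) * Y ^ p.2) := by
    have hs (m : ℕ) := (hasSum_choose_mul_geometric_of_norm_lt_one (2 * m) (r := Y)
      (by rwa [Real.norm_of_nonneg hY])).mul_left ((4 * (X * Y)) ^ m)
    refine (summable_prod_of_nonneg fun p => by positivity).2 ⟨fun m => (hs m).summable, ?_⟩
    simp only [(hs _).tsum_eq]
    have := (summable_geometric_of_lt_one (r := 4 * (X * Y) / (1 - Y) ^ 2) (by positivity)
      ((div_lt_one (by positivity)).2 h4)).mul_left (1 / (1 - Y))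
    refine this.congr fun m => ?_
    rw [div_pow, pow_succ (1 - Y) (2 * m), pow_mul (1 - Y) 2 m]
    field_simp
  refine (summable_subtype_and_compl (s := {p : ℕ × ℕ | p.2 ≤ p.1})).1 ⟨?_, ?_⟩
  · refine Summable.of_nonneg_of_le
      (fun p => mul_nonneg (mul_nonneg (hornMajorant_nonneg _) (by positivity)) (by positivity))
      (fun p => ?_) (g1.comp_injective
        (i := fun p : {p : ℕ × ℕ | p.2 ≤ p.1} => (p.1.1 - p.1.2, p.1.2)) ?_)
    · obtain ⟨⟨m, n⟩, hp⟩ := p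
      obtain ⟨j, rfl⟩ := Nat.exists_eq_add_of_le (show n ≤ m from hp)
      simp only [Function.comp_apply, Nat.add_sub_cancel_left]
      calc hornMajorant (n + j, n) * X ^ (n + j) * Y ^ n ≤ 4 ^ n * X ^ (n + j) * Y ^ n := by
            gcongr; exact hornMajorant_le_left n j
        _ = _ := by rw [mul_pow, mul_pow, pow_add]; ring
    · rintro ⟨⟨m, n⟩, hp⟩ ⟨⟨m', n'⟩, hp'⟩ he
      have h1 : n ≤ m := hp
      have h2 : n' ≤ m' := hp'
      simp only [Prod.mk.injEq, Subtype.mk.injEq] at *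
      omega
  · refine Summable.of_nonneg_of_le
      (fun p => mul_nonneg (mul_nonneg (hornMajorant_nonneg _) (by positivity)) (by positivity))
      (fun p => ?_) (g2.comp_injective
        (i := fun p : ({p : ℕ × ℕ | p.2 ≤ p.1}ᶜ : Set (ℕ × ℕ)) => (p.1.1, p.1.2 - p.1.1)) ?_)
    · obtain ⟨⟨m, n⟩, hp⟩ := p
      obtain ⟨j, rfl⟩ := Nat.exists_eq_add_of_le (le_of_not_ge (show ¬ n ≤ m from hp))
      simp only [Function.comp_apply, Nat.add_sub_cancel_left]
      calc hornMajorant (m, m + j) * X ^ m * Y ^ (m + j)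
          ≤ (j + 2 * m).choose (2 * m) * 4 ^ m * X ^ m * Y ^ (m + j) := by
            gcongr; exact hornMajorant_le_right m j
        _ = _ := by rw [mul_pow, mul_pow, pow_add]; ring
    · rintro ⟨⟨m, n⟩, hp⟩ ⟨⟨m', n'⟩, hp'⟩ he
      have h1 : ¬ n ≤ m := hp
      have h2 : ¬ n' ≤ m' := hp'
      simp only [Prod.mk.injEq, Subtype.mk.injEq] at *
      omega

/-- The common form of the coefficients of the three double series: the coefficient of
`x ^ m * y ^ n` is `(A)_{m-n} (B)_{m+n} / (m! (D)_m)` times a factor depending on `n` only. -/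
def hornCoeff (A B D : ℂ) (g : ℕ → ℂ) (p : ℕ × ℕ) : ℂ :=
  poch A ((p.1 : ℤ) - p.2) * poch B ((p.1 : ℤ) + p.2) / (p.1 ! * poch D p.1) * g p.2

variable {A B D : ℂ} {g : ℕ → ℂ}

lemma exists_norm_hornCoeff_le (A B D : ℂ) (hg : SubExp g) {Q : ℝ} (hQ : 1 < Q) :
    ∃ K, ∀ p, ‖hornCoeff A B D g p‖ ≤ K * (Q ^ p.1 * Q ^ p.2 * hornMajorant p) := by
  -- The growth factors of the five sequences multiply to `q ^ (3 * (m + n))`.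
  set q := Q ^ ((1 : ℝ) / 3) with hq
  have hq1 : 1 < q := Real.one_lt_rpow hQ (by norm_num)
  have hq3 : q ^ 3 = Q := by
    rw [hq, ← Real.rpow_natCast, ← Real.rpow_mul (by linarith)]
    norm_num
  obtain ⟨K₁, hK₁, h₁⟩ := subExp_poch_div_factorial A q hq1
  obtain ⟨K₂, hK₂, h₂⟩ := subExp_factorial_mul_poch_neg A q hq1
  obtain ⟨K₃, hK₃, h₃⟩ := subExp_poch_div_factorial B q hq1
  obtain ⟨K₄, hK₄, h₄⟩ := subExp_factorial_div_poch D q hq1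
  obtain ⟨K₅, hK₅, h₅⟩ := hg q hq1
  refine ⟨(K₁ + K₂) * K₃ * K₄ * K₅, fun ⟨m, n⟩ => ?_⟩
  have hA : ‖poch A ((m : ℤ) - n)‖ ≤ (K₁ + K₂) * q ^ (m + n) *
      (if n ≤ m then ((m - n)! : ℝ) else ((n - m)! : ℝ)⁻¹) := by
    split_ifs with hnm
    · obtain ⟨k, rfl⟩ := Nat.exists_eq_add_of_le hnm
      have := h₁ k
      rw [norm_div, Complex.norm_natCast, div_le_iff₀ (by positivity)] at this
      rw [show ((n + k : ℕ) : ℤ) - n = (k : ℕ) by push_cast; ring, Nat.add_sub_cancel_left]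
      refine this.trans ?_
      gcongr
      · linarith
      · exact hq1.le
      · omega
    · obtain ⟨k, rfl⟩ := Nat.exists_eq_add_of_le (not_le.1 hnm).le
      have := h₂ k
      rw [norm_mul, Complex.norm_natCast, ← le_div_iff₀' (by positivity)] at this
      rw [show (m : ℤ) - ((m + k : ℕ) : ℤ) = -(k : ℕ) by push_cast; ring, Nat.add_sub_cancel_left]
      refine this.trans ?_
      rw [div_eq_mul_inv]
      gcongr
      · linarith
      · exact hq1.le
      · omega
  have hB : ‖poch B ((m : ℤ) + n)‖ ≤ K₃ * q ^ (m + n) * (m + n)! := by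
    have := h₃ (m + n)
    rw [norm_div, Complex.norm_natCast, div_le_iff₀ (by positivity)] at this
    exact_mod_cast this
  have hg' : ‖g n‖ ≤ K₅ * q ^ n := h₅ n
  have hm : ‖(m ! : ℂ)⁻¹‖ = (m ! : ℝ)⁻¹ := by rw [norm_inv, Complex.norm_natCast]
  have hD : ‖(poch D m)⁻¹‖ ≤ K₄ * q ^ m / m ! := by
    have : ‖(m ! : ℂ) / poch D m‖ ≤ K₄ * q ^ m := h₄ m
    rwa [div_eq_mul_inv, norm_mul, Complex.norm_natCast, ← le_div_iff₀' (by positivity)] at this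
  unfold hornCoeff hornMajorant
  simp only
  rw [div_eq_mul_inv, mul_inv, norm_mul, norm_mul, norm_mul, norm_mul, hm]
  calc _ ≤ ((K₁ + K₂) * q ^ (m + n) *
          (if n ≤ m then ((m - n)! : ℝ) else ((n - m)! : ℝ)⁻¹)) * (K₃ * q ^ (m + n) * (m + n)!) *
          ((m ! : ℝ)⁻¹ * (K₄ * q ^ m / m !)) * (K₅ * q ^ n) := by
        gcongr
    _ = _ := by
        rw [← hq3]
        generalize (if n ≤ m then ((m - n)! : ℝ) else ((n - m)! : ℝ)⁻¹) = σ
        field_simp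
        ring

/-- The region is open, so there is room for the factors of subexponential growth. -/
lemma summable_norm_hornCoeff (A B D : ℂ) (hg : SubExp g) {X Y : ℝ} (hX : 0 ≤ X) (hY : 0 ≤ Y)
    (h : (X, Y) ∈ absRegion) :
    Summable fun p : ℕ × ℕ => ‖hornCoeff A B D g p‖ * X ^ p.1 * Y ^ p.2 := by
  have hc : Tendsto (fun Q : ℝ => (Q * X, Q * Y)) (𝓝[>] 1) (𝓝 (X, Y)) := by
    have : ContinuousAt (fun Q : ℝ => (Q * X, Q * Y)) 1 := by fun_prop
    have := this.tendsto
    simp only [one_mul] at this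
    exact this.mono_left nhdsWithin_le_nhds
  obtain ⟨Q, hQ, hQ1⟩ := ((hc.eventually (isOpen_absRegion.mem_nhds h)).and
    self_mem_nhdsWithin).exists
  have hQ0 : (0 : ℝ) < Q := zero_lt_one.trans hQ1
  obtain ⟨K, hK⟩ := exists_norm_hornCoeff_le A B D hg hQ1
  refine Summable.of_nonneg_of_le (fun p => by positivity) (fun p => ?_)
    ((summable_hornMajorant (X := Q * X) (Y := Q * Y) (by positivity) (by positivity)
      hQ).mul_left K)
  calc ‖hornCoeff A B D g p‖ * X ^ p.1 * Y ^ p.2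
      ≤ K * (Q ^ p.1 * Q ^ p.2 * hornMajorant p) * X ^ p.1 * Y ^ p.2 := by gcongr; exact hK p
    _ = _ := by rw [mul_pow, mul_pow]; ring

lemma norm_mem_absRegion {q : ℂ × ℂ} : (‖q.1‖, ‖q.2‖) ∈ absRegion ↔ q ∈ hornH1Region := Iff.rfl

lemma summable_hornCoeff (A B D : ℂ) (hg : SubExp g) {x y : ℂ} (h : (x, y) ∈ hornH1Region) :
    Summable fun p : ℕ × ℕ => hornCoeff A B D g p * x ^ p.1 * y ^ p.2 := by
  refine Summable.of_norm ?_
  simpa only [norm_mul, norm_pow] using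
    summable_norm_hornCoeff A B D hg (norm_nonneg x) (norm_nonneg y) (norm_mem_absRegion.2 h)

end Convergence

/-! ### The connection formula for `H₁` -/

section DoubleSeries

lemma subExp_hornFactor (c : ℂ) : SubExp fun n => poch c n / n ! := subExp_poch_div_factorial c

/-- The two inserted factorials cancel; they split the factor into three factors each of which has
subexponential growth. -/
lemma subExp_at10Factor (a b c d : ℂ) :
    SubExp fun n => poch c n / n ! * (poch (b - d + 1) n / n ! * (n ! / poch (d - a) n)) :=
  (subExp_poch_div_factorial c).mul
    ((subExp_poch_div_factorial (b - d + 1)).mul (subExp_factorial_div_poch (d - a)))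

lemma hornH1Term_eq (a b c d x y : ℂ) (p : ℕ × ℕ) :
    hornH1Term a b c d x y p =
      hornCoeff a b d (fun n => poch c n / n !) p * x ^ p.1 * y ^ p.2 := by
  unfold hornH1Term hornCoeff
  ring

lemma at10Term₁_eq (a b c d x y : ℂ) (p : ℕ × ℕ) :
    at10Term₁ a b c d x y p =
      hornCoeff a b (a + b - d + 1)
        (fun n => poch c n / n ! * (poch (b - d + 1) n / n ! * (n ! / poch (d - a) n))) p *
        (1 - x) ^ p.1 * (-y) ^ p.2 := by
  have : (p.2 ! : ℂ) ≠ 0 := by exact_mod_cast p.2.factorial_ne_zero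
  have h : poch (b - d + 1) p.2 / (p.2 ! : ℂ) * (p.2 ! / poch (d - a) p.2) =
      poch (b - d + 1) p.2 / poch (d - a) p.2 := div_mul_div_cancel₀ this
  unfold at10Term₁ hornCoeff
  simp only [h]
  ring

lemma at10Term₂_eq (a b c d x y : ℂ) (p : ℕ × ℕ) :
    at10Term₂ a b c d x y p =
      hornCoeff (d - b) (d - a) (d - a - b + 1)
        (fun n => poch c n / n ! * (poch (b - d + 1) n / n ! * (n ! / poch (d - a) n))) p *
        (1 - x) ^ p.1 * (-y) ^ p.2 := by
  have : (p.2 ! : ℂ) ≠ 0 := by exact_mod_cast p.2.factorial_ne_zero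
  have h : poch (b - d + 1) p.2 / (p.2 ! : ℂ) * (p.2 ! / poch (d - a) p.2) =
      poch (b - d + 1) p.2 / poch (d - a) p.2 := div_mul_div_cancel₀ this
  unfold at10Term₂ hornCoeff
  simp only [h]
  ring

lemma summable_hornH1Term (a b c d : ℂ) {x y : ℂ} (h : (x, y) ∈ hornH1Region) :
    Summable (hornH1Term a b c d x y) := by
  simpa only [← hornH1Term_eq] using summable_hornCoeff a b d (subExp_hornFactor c) h

lemma summable_at10Term₁ (a b c d : ℂ) {x y : ℂ} (h : (x, y) ∈ at10Region) :
    Summable (at10Term₁ a b c d x y) := by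
  simpa only [← at10Term₁_eq] using
    summable_hornCoeff a b (a + b - d + 1) (subExp_at10Factor a b c d) (x := 1 - x) (y := -y) h

lemma summable_at10Term₂ (a b c d : ℂ) {x y : ℂ} (h : (x, y) ∈ at10Region) :
    Summable (at10Term₂ a b c d x y) := by
  simpa only [← at10Term₂_eq] using
    summable_hornCoeff (d - b) (d - a) (d - a - b + 1) (subExp_at10Factor a b c d)
      (x := 1 - x) (y := -y) h

/-- Summation over `m` turns a double series of Horn type into a series of Gauss hypergeometric
functions with shifted parameters. -/
lemma hasSum_hornCoeff {A B D : ℂ} (hA : ∀ k : ℤ, A ≠ k) (hB : NonPole B) {g : ℕ → ℂ}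
    (hg : SubExp g) {x y : ℂ} (h : (x, y) ∈ hornH1Region) :
    HasSum (fun n : ℕ => poch A (-(n : ℤ)) * poch B n * g n * y ^ n * ₂F₁ (A - n) (B + n) D x)
      (∑' p : ℕ × ℕ, hornCoeff A B D g p * x ^ p.1 * y ^ p.2) := by
  have hs := (summable_hornCoeff A B D hg h).hasSum
  rw [← (Equiv.prodComm ℕ ℕ).hasSum_iff] at hs
  refine hs.prod_fiberwise fun n => ?_
  have := ((subExp_hgCoeff (A - n) (B + n) D).hasSum h.2.1).mul_left
    (poch A (-(n : ℤ)) * poch B n * g n * y ^ n)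
  rw [← hypergeometric_eq_tsum] at this
  convert! this using 2 with m
  simp only [Function.comp_apply, Equiv.prodComm_apply, Prod.swap_prod_mk]
  unfold hornCoeff
  simp only [hgCoeff, ordinaryHypergeometricCoefficient]
  rw [poch_sub hA, poch_add hB, poch_natCast D, div_eq_mul_inv, mul_inv]
  ring

lemma hypergeometric_symm (A B C x : ℂ) : ₂F₁ A B C x = ₂F₁ B A C x := by
  unfold ordinaryHypergeometric
  rw [ordinaryHypergeometricSeries_symm]

end DoubleSeries

section Identity

variable {a b c d : ℂ}

/-- The connection formula between convergent series: the one for `₂F₁` with the parameters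
`a - n`, `b + n`, `d`, multiplied by `(a)_{-n} (b)_n (c)_n / n! * y ^ n` and summed over `n`. -/
theorem hornH1_eq_at10Sum (ha : ∀ k : ℤ, a ≠ k) (hb : NonPole b) (hd : NonPole d)
    (hda : NonPole (d - a)) (hdb : ∀ k : ℤ, d - b ≠ k) (habd : ∀ k : ℤ, a + b - d ≠ k)
    {x y : ℂ} (h0 : (x, y) ∈ hornH1Region) (h1 : (x, y) ∈ at10Region) :
    hornH1 a b c d x y = at10Sum a b c d ((1 - x) ^ (d - a - b)) x y := by
  have hlens : x ∈ hgLens := ⟨h0.2.1, h1.2.1⟩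
  have s0 := hasSum_hornCoeff (D := d) ha hb (subExp_hornFactor c) h0
  have s1 := hasSum_hornCoeff (D := a + b - d + 1) (x := 1 - x) (y := -y) ha hb
    (subExp_at10Factor a b c d) h1
  have s2 := hasSum_hornCoeff (D := d - a - b + 1) (x := 1 - x) (y := -y) hdb hda
    (subExp_at10Factor a b c d) h1
  simp only [← hornH1Term_eq, ← at10Term₁_eq, ← at10Term₂_eq] at s0 s1 s2
  unfold hornH1 at10Sum
  refine s0.unique ?_
  convert! (s1.mul_left (Complex.Gamma d * Complex.Gamma (d - a - b) /
      (Complex.Gamma (d - a) * Complex.Gamma (d - b)))).add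
    (s2.mul_left ((1 - x) ^ (d - a - b) * (Complex.Gamma d * Complex.Gamma (a + b - d) /
      (Complex.Gamma a * Complex.Gamma b)))) using 2 with n
  have hgen : HGGeneric (a - n) (b + n) d := by
    refine ⟨nonPole_sub_nat ha n, hb.add_nat n, hd, ?_, ?_, fun k hk => habd (-k) ?_⟩
    · rw [show d - (a - n) = d - a + n by ring]
      exact hda.add_nat n
    · rw [show d - (b + n) = d - b - n by ring]
      exact nonPole_sub_nat hdb n
    · push_cast
      linear_combination -hk
  rw [hgen.eq_hgU_add_hgV x hlens]
  unfold hgU hgV gaussValue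
  rw [show d - (a - n) - (b + n) = d - a - b by ring, show a - n + (b + n) - d = a + b - d by ring,
    show d - (a - n) = d - a + n by ring, show d - (b + n) = d - b - n by ring,
    Gamma_add_natCast hda, Gamma_add_natCast hb, ← poch_natCast, ← poch_natCast,
    ← Gamma_mul_poch_neg ha, ← Gamma_mul_poch_neg hdb,
    hypergeometric_symm (d - b - n) (d - a + n)]
  have e := poch_neg_mul_poch_one_sub hdb n
  rw [show 1 - (d - b) = b - d + 1 by ring] at e
  have n1 := poch_neg_ne_zero ha n
  have n2 : poch b n ≠ 0 := hb.poch_ne_zero n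
  have n3 : poch (d - a) n ≠ 0 := hda.poch_ne_zero n
  have n4 := poch_neg_ne_zero hdb n
  have g1 := (NonPole.of_not_int ha).Gamma_ne_zero
  have g2 := hb.Gamma_ne_zero
  have g3 := hda.Gamma_ne_zero
  have g4 := (NonPole.of_not_int hdb).Gamma_ne_zero
  have hf : (n ! : ℂ) ≠ 0 := by exact_mod_cast n.factorial_ne_zero
  have e2 : poch (b - d + 1) n = (-1) ^ n / poch (d - b) (-(n : ℤ)) := by
    rw [← e, mul_div_cancel_left₀ _ n4]
  have e3 : ((-1 : ℂ) ^ n) * (-1) ^ n = 1 := by rw [← mul_pow]; simp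
  rw [e2, neg_pow y]
  generalize ₂F₁ (a - n) (b + n) (a + b - d + 1) (1 - x) = Φ₁
  generalize ₂F₁ (d - a + n) (d - b - n) (d - a - b + 1) (1 - x) = Φ₂
  generalize (1 - x) ^ (d - a - b) = P
  generalize (-1 : ℂ) ^ n = s at *
  field_simp
  rw [sq, e3]
  ring

end Identity

/-! ### Analyticity in two variables and connectedness of the regions -/

section Analyticity

/-- The monomial `q.1 ^ m * q.2 ^ (N - m)` of degree `N ≥ m` as a multilinear map. -/
def monomialMultilinear (N m : ℕ) : ContinuousMultilinearMap ℂ (fun _ : Fin N => ℂ × ℂ) ℂ :=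
  (ContinuousMultilinearMap.mkPiAlgebra ℂ (Fin N) ℂ).compContinuousLinearMap
    (fun i => if (i : ℕ) < m then ContinuousLinearMap.fst ℂ ℂ ℂ else ContinuousLinearMap.snd ℂ ℂ ℂ)

lemma norm_monomialMultilinear_le (N m : ℕ) : ‖monomialMultilinear N m‖ ≤ 1 := by
  refine ContinuousMultilinearMap.opNorm_le_bound zero_le_one fun v => ?_
  rw [one_mul, monomialMultilinear, ContinuousMultilinearMap.compContinuousLinearMap_apply,
    ContinuousMultilinearMap.mkPiAlgebra_apply, norm_prod]
  refine Finset.prod_le_prod (fun _ _ => norm_nonneg _) fun i _ => ?_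
  split_ifs
  exacts [norm_fst_le _, norm_snd_le _]

lemma monomialMultilinear_apply_const (m n : ℕ) (q : ℂ × ℂ) :
    monomialMultilinear (m + n) m (fun _ => q) = q.1 ^ m * q.2 ^ n := by
  rw [monomialMultilinear, ContinuousMultilinearMap.compContinuousLinearMap_apply,
    ContinuousMultilinearMap.mkPiAlgebra_apply]
  have : ∀ i : Fin (m + n), (if (i : ℕ) < m then ContinuousLinearMap.fst ℂ ℂ ℂ
      else ContinuousLinearMap.snd ℂ ℂ ℂ) q = (fun i : ℕ => if i < m then q.1 else q.2) i := by
    intro i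
    simp only
    split_ifs <;> rfl
  rw [Finset.prod_congr rfl fun i _ => this i,
    Fin.prod_univ_eq_prod_range (fun i : ℕ => if i < m then q.1 else q.2), Finset.prod_range_add]
  congr 1
  · rw [Finset.prod_congr rfl fun i hi => if_pos (Finset.mem_range.1 hi), Finset.prod_const,
      Finset.card_range]
  · simp

/-- The double power series with coefficients `c`, grouped by total degree. -/
def doubleSeries (c : ℕ × ℕ → ℂ) : FormalMultilinearSeries ℂ (ℂ × ℂ) ℂ := fun N =>
  ∑ p ∈ Finset.HasAntidiagonal.antidiagonal N, c p • monomialMultilinear N p.1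

lemma hasFPowerSeriesOnBall_doubleSeries {c : ℕ × ℕ → ℂ} (hc : Summable fun p => ‖c p‖) :
    HasFPowerSeriesOnBall (fun q : ℂ × ℂ => ∑' p, c p * q.1 ^ p.1 * q.2 ^ p.2)
      (doubleSeries c) 0 1 where
  r_le := by
    refine (doubleSeries c).le_radius_of_bound (r := 1) (∑' p, ‖c p‖) fun N => ?_
    rw [NNReal.coe_one, one_pow, mul_one]
    refine (norm_sum_le _ _).trans (le_trans (Finset.sum_le_sum fun p _ => ?_)
      (hc.sum_le_tsum (Finset.HasAntidiagonal.antidiagonal N) fun _ _ => norm_nonneg _))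
    rw [norm_smul]
    exact mul_le_of_le_one_right (norm_nonneg _) (norm_monomialMultilinear_le _ _)
  r_pos := one_pos
  hasSum {q} hq := by
    rw [zero_add]
    have hq' : ‖q‖ < 1 := by
      simpa [enorm_eq_nnnorm, ← NNReal.coe_lt_coe] using hq
    have hs : Summable fun p : ℕ × ℕ => c p * q.1 ^ p.1 * q.2 ^ p.2 := by
      refine Summable.of_norm_bounded hc fun p => ?_
      rw [norm_mul, norm_mul, norm_pow, norm_pow, mul_assoc]
      refine mul_le_of_le_one_right (norm_nonneg _) (mul_le_one₀ ?_ (by positivity) ?_)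
      · exact pow_le_one₀ (norm_nonneg _) ((norm_fst_le q).trans hq'.le)
      · exact pow_le_one₀ (norm_nonneg _) ((norm_snd_le q).trans hq'.le)
    have := (Finset.HasAntidiagonal.sigmaAntidiagonalEquivProd.hasSum_iff.2 hs.hasSum).sigma
      (fun N => hasSum_fintype _)
    convert! this using 2 with N
    rw [doubleSeries, sum_apply, ← Finset.sum_coe_sort]
    refine Finset.sum_congr rfl fun p _ => ?_
    obtain ⟨⟨m, n⟩, hp⟩ := p
    obtain rfl := Finset.HasAntidiagonal.mem_antidiagonal.1 hp
    rw [smul_apply, monomialMultilinear_apply_const, smul_eq_mul,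
      ← mul_assoc]
    rfl

lemma analyticAt_double_tsum {c : ℕ × ℕ → ℂ} {ρ σ : ℝ}
    (hc : Summable fun p => ‖c p‖ * ρ ^ p.1 * σ ^ p.2) {q : ℂ × ℂ} (h1 : ‖q.1‖ < ρ)
    (h2 : ‖q.2‖ < σ) :
    AnalyticAt ℂ (fun q : ℂ × ℂ => ∑' p, c p * q.1 ^ p.1 * q.2 ^ p.2) q := by
  have hρ : 0 < ρ := (norm_nonneg _).trans_lt h1
  have hσ : 0 < σ := (norm_nonneg _).trans_lt h2
  have hρ' : (ρ : ℂ) ≠ 0 := by exact_mod_cast hρ.ne'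
  have hσ' : (σ : ℂ) ≠ 0 := by exact_mod_cast hσ.ne'
  have hs : Summable fun p : ℕ × ℕ => ‖c p * (ρ : ℂ) ^ p.1 * (σ : ℂ) ^ p.2‖ := by
    simpa [abs_of_pos hρ, abs_of_pos hσ] using hc
  have hL : AnalyticAt ℂ (fun q : ℂ × ℂ => (q.1 / (ρ : ℂ), q.2 / (σ : ℂ))) q :=
    (analyticAt_fst.div_const).prod (analyticAt_snd.div_const)
  have hm : ((q.1 / (ρ : ℂ), q.2 / (σ : ℂ)) : ℂ × ℂ) ∈ Metric.eball (0 : ℂ × ℂ) 1 := by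
    have : ‖((q.1 / (ρ : ℂ), q.2 / (σ : ℂ)) : ℂ × ℂ)‖ < 1 := by
      rw [Prod.norm_def, max_lt_iff]
      simp only [norm_div, Complex.norm_real, Real.norm_of_nonneg hρ.le, Real.norm_of_nonneg hσ.le]
      exact ⟨(div_lt_one hρ).2 h1, (div_lt_one hσ).2 h2⟩
    simpa [enorm_eq_nnnorm, ← NNReal.coe_lt_coe] using this
  have key := ((hasFPowerSeriesOnBall_doubleSeries hs).analyticAt_of_mem hm).comp
    (f := fun q : ℂ × ℂ => (q.1 / (ρ : ℂ), q.2 / (σ : ℂ))) hL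
  convert! key using 2 with q
  refine tsum_congr fun p => ?_
  simp only [div_pow]
  field_simp

lemma analyticOnNhd_hornCoeff (A B D : ℂ) {g : ℕ → ℂ} (hg : SubExp g) :
    AnalyticOnNhd ℂ (fun q : ℂ × ℂ => ∑' p, hornCoeff A B D g p * q.1 ^ p.1 * q.2 ^ p.2)
      hornH1Region := by
  intro q hq
  have hc : Tendsto (fun ε : ℝ => (‖q.1‖ + ε, ‖q.2‖ + ε)) (𝓝[>] 0) (𝓝 (‖q.1‖, ‖q.2‖)) := by
    have : ContinuousAt (fun ε : ℝ => (‖q.1‖ + ε, ‖q.2‖ + ε)) 0 := by fun_prop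
    have := this.tendsto
    simp only [add_zero] at this
    exact this.mono_left nhdsWithin_le_nhds
  obtain ⟨ε, hε, hε0⟩ := ((hc.eventually (isOpen_absRegion.mem_nhds
    (norm_mem_absRegion.2 hq))).and self_mem_nhdsWithin).exists
  have hε0 : 0 < ε := hε0
  exact analyticAt_double_tsum (summable_norm_hornCoeff A B D hg (by positivity) (by positivity) hε)
    (lt_add_of_pos_right _ hε0) (lt_add_of_pos_right _ hε0)

lemma isOpen_hornH1Region : IsOpen hornH1Region :=
  isOpen_absRegion.preimage (f := fun q : ℂ × ℂ => (‖q.1‖, ‖q.2‖)) (by fun_prop)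

lemma isOpen_at10Region : IsOpen at10Region :=
  isOpen_hornH1Region.preimage (f := fun q : ℂ × ℂ => (1 - q.1, -q.2)) (by fun_prop)

lemma analyticOnNhd_hornH1 (a b c d : ℂ) :
    AnalyticOnNhd ℂ (fun q : ℂ × ℂ => hornH1 a b c d q.1 q.2) hornH1Region := by
  unfold hornH1
  simpa only [← hornH1Term_eq] using analyticOnNhd_hornCoeff a b d (subExp_hornFactor c)

lemma analyticOnNhd_at10Map (s : Set (ℂ × ℂ)) :
    AnalyticOnNhd ℂ (fun q : ℂ × ℂ => (1 - q.1, -q.2)) s := fun _ _ =>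
  (analyticAt_const.sub analyticAt_fst).prod analyticAt_snd.neg

/-- The right-hand side of the connection formula is analytic in `(x, y)` and in the value of the
power. -/
lemma analyticAt_at10Sum (a b c d : ℂ) {P X Y : ℂ × ℂ → ℂ} {q : ℂ × ℂ} (hP : AnalyticAt ℂ P q)
    (hX : AnalyticAt ℂ X q) (hY : AnalyticAt ℂ Y q) (hq : (X q, Y q) ∈ at10Region) :
    AnalyticAt ℂ (fun q => at10Sum a b c d (P q) (X q) (Y q)) q := by
  have h1 := (analyticOnNhd_hornCoeff a b (a + b - d + 1) (subExp_at10Factor a b c d)).comp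
    (analyticOnNhd_at10Map at10Region) fun _ h => h
  have h2 := (analyticOnNhd_hornCoeff (d - b) (d - a) (d - a - b + 1)
    (subExp_at10Factor a b c d)).comp (analyticOnNhd_at10Map at10Region) fun _ h => h
  have e1 := (h1 _ hq).comp (f := fun q => (X q, Y q)) (hX.prod hY)
  have e2 := (h2 _ hq).comp (f := fun q => (X q, Y q)) (hX.prod hY)
  simp only [Function.comp_def, ← at10Term₁_eq, ← at10Term₂_eq] at e1 e2
  unfold at10Sum
  exact (analyticAt_const.mul e1).add ((hP.mul analyticAt_const).mul e2)

end Analyticity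

section Connectedness

lemma mem_hornH1Region_of_norm_le {x y y' : ℂ} (h : (x, y) ∈ hornH1Region) (hy : ‖y'‖ ≤ ‖y‖) :
    (x, y') ∈ hornH1Region := by
  obtain ⟨h1, h2, h3⟩ := h
  refine ⟨lt_of_le_of_lt ?_ h1, h2, hy.trans_lt h3⟩
  simp only
  gcongr

lemma mem_at10Region_of_norm_le {x y y' : ℂ} (h : (x, y) ∈ at10Region) (hy : ‖y'‖ ≤ ‖y‖) :
    (x, y') ∈ at10Region :=
  mem_hornH1Region_of_norm_le (y := -y) h (by simpa using hy)

lemma zero_mem_at10Region_iff {x : ℂ} : (x, (0 : ℂ)) ∈ at10Region ↔ ‖1 - x‖ < 1 := by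
  simp [at10Region, hornH1Region]

/-- A subset of `ℂ × ℂ` that can be contracted in the second variable to a preconnected set is
preconnected. -/
lemma isPreconnected_of_contract_snd {Ω : Set (ℂ × ℂ)} {x₀ : ℂ} (h₀ : (x₀, (0 : ℂ)) ∈ Ω)
    (hb : IsPreconnected {x : ℂ | (x, (0 : ℂ)) ∈ Ω})
    (hc : ∀ x y : ℂ, (x, y) ∈ Ω → ∀ t ∈ Icc (0 : ℝ) 1, (x, (t : ℂ) * y) ∈ Ω) :
    IsPreconnected Ω := by
  refine isPreconnected_of_forall (x₀, (0 : ℂ)) fun ⟨x, y⟩ hxy => ?_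
  have hx0 : (x, (0 : ℂ)) ∈ Ω := by simpa using hc x y hxy 0 (by simp)
  refine ⟨(fun x => (x, (0 : ℂ))) '' {x : ℂ | (x, (0 : ℂ)) ∈ Ω} ∪
    (fun t : ℝ => (x, (t : ℂ) * y)) '' Icc 0 1, ?_, .inl ⟨x₀, h₀, rfl⟩, .inr ⟨1, by simp⟩, ?_⟩
  · rintro _ (⟨z, hz, rfl⟩ | ⟨t, ht, rfl⟩)
    · exact hz
    · exact hc x y hxy t ht
  · refine (hb.image _ (by fun_prop)).union (x, (0 : ℂ)) ⟨x, hx0, rfl⟩ ⟨0, by simp⟩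
      (isPreconnected_Icc.image _ (by fun_prop))

lemma half_mem : ((1 / 2 : ℂ), (0 : ℂ)) ∈ hornH1Region ∧ ((1 / 2 : ℂ), (0 : ℂ)) ∈ at10Region := by
  constructor
  · simp [hornH1Region]; norm_num
  · rw [zero_mem_at10Region_iff]; norm_num

lemma norm_ofReal_mul_le {t : ℝ} (ht : t ∈ Icc (0 : ℝ) 1) (y : ℂ) : ‖(t : ℂ) * y‖ ≤ ‖y‖ := by
  rw [norm_mul, Complex.norm_real, Real.norm_of_nonneg ht.1]
  exact mul_le_of_le_one_left (norm_nonneg _) ht.2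

/-- The region around `(1, 0)`, cut along the real half-line `x ≥ 1`. -/
def at10CutRegion : Set (ℂ × ℂ) := {q | q ∈ at10Region ∧ 1 - q.1 ∈ Complex.slitPlane}

lemma isOpen_at10CutRegion : IsOpen at10CutRegion :=
  isOpen_at10Region.inter (Complex.isOpen_slitPlane.preimage (f := fun q : ℂ × ℂ => 1 - q.1)
    (by fun_prop))

lemma half_mem_at10CutRegion : ((1 / 2 : ℂ), (0 : ℂ)) ∈ at10CutRegion :=
  ⟨half_mem.2, one_sub_mem_slitPlane_of_norm_lt half_mem.1.2.1⟩

lemma isPreconnected_at10CutRegion : IsPreconnected at10CutRegion := by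
  refine isPreconnected_of_contract_snd half_mem_at10CutRegion ?_ fun x y h t ht =>
    ⟨mem_at10Region_of_norm_le h.1 (norm_ofReal_mul_le ht y), h.2⟩
  have hp : IsPreconnected (Metric.ball (0 : ℂ) 1 ∩ Complex.slitPlane) := by
    have hs : StarConvex ℝ (((1 / 2 : ℝ)) : ℂ) (Metric.ball (0 : ℂ) 1 ∩ Complex.slitPlane) :=
      ((convex_ball 0 1).starConvex (by simp; norm_num)).inter
        (Complex.starConvex_ofReal_slitPlane (by norm_num))
    refine (hs.isPathConnected ⟨?_, ?_⟩).isConnected.isPreconnected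
    · simp; norm_num
    · exact Complex.ofReal_mem_slitPlane.2 (by norm_num)
  convert! hp.image (fun t : ℂ => 1 - t) (by fun_prop) using 1
  ext x
  simp only [at10CutRegion, mem_ofPred_eq, zero_mem_at10Region_iff, mem_image, mem_inter_iff,
    mem_ball_zero_iff]
  constructor
  · rintro ⟨h1, h2⟩
    exact ⟨1 - x, ⟨h1, h2⟩, by ring⟩
  · rintro ⟨t, ⟨h1, h2⟩, rfl⟩
    rw [sub_sub_cancel]
    exact ⟨h1, h2⟩

/-- The region around `(1, 0)` in terms of `w = log (1 - x)`. -/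
def at10LogRegion : Set (ℂ × ℂ) := {q | (1 - Complex.exp q.1, q.2) ∈ at10Region}

lemma isOpen_at10LogRegion : IsOpen at10LogRegion :=
  isOpen_at10Region.preimage (f := fun q : ℂ × ℂ => (1 - Complex.exp q.1, q.2)) (by fun_prop)

lemma exp_log_half : Complex.exp (Real.log (1 / 2) : ℝ) = 1 / 2 := by
  rw [← Complex.ofReal_exp, Real.exp_log (by norm_num)]
  norm_num

lemma log_half_mem_at10LogRegion : (((Real.log (1 / 2) : ℝ) : ℂ), (0 : ℂ)) ∈ at10LogRegion := by
  unfold at10LogRegion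
  simp only [mem_ofPred_eq]
  rw [exp_log_half, zero_mem_at10Region_iff]
  norm_num

lemma isPreconnected_at10LogRegion : IsPreconnected at10LogRegion := by
  refine isPreconnected_of_contract_snd log_half_mem_at10LogRegion ?_ fun x y h t ht =>
    mem_at10Region_of_norm_le h (norm_ofReal_mul_le ht y)
  convert! (convex_halfSpace_re_lt 0).isPreconnected using 1
  ext w
  simp only [at10LogRegion, mem_ofPred_eq, zero_mem_at10Region_iff, sub_sub_cancel,
    Complex.norm_exp, Real.exp_lt_one_iff]

end Connectedness

/-! ### Analytic continuation of `H₁` -/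

section Continuation

variable {a b c d : ℂ}

/-- The right-hand side of the connection formula as a function on the cut region. -/
lemma analyticOnNhd_at10Sum_cut (a b c d : ℂ) :
    AnalyticOnNhd ℂ (fun q : ℂ × ℂ => at10Sum a b c d ((1 - q.1) ^ (d - a - b)) q.1 q.2)
      at10CutRegion := fun _ hq =>
  analyticAt_at10Sum a b c d ((analyticAt_const.sub analyticAt_fst).cpow analyticAt_const hq.2)
    analyticAt_fst analyticAt_snd hq.1

/-- The right-hand side of the connection formula, with all branches of the power, as a function of
`w = log (1 - x)` and `y`. -/
lemma analyticOnNhd_at10Sum_log (a b c d : ℂ) :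
    AnalyticOnNhd ℂ (fun q : ℂ × ℂ =>
      at10Sum a b c d (Complex.exp ((d - a - b) * q.1)) (1 - Complex.exp q.1) q.2)
      at10LogRegion := fun _ hq =>
  analyticAt_at10Sum a b c d (analyticAt_const.mul analyticAt_fst).cexp
    (analyticAt_const.sub analyticAt_fst.cexp) analyticAt_snd hq

lemma exp_cpow_of_abs_im_lt {w : ℂ} (hw : |w.im| < Real.pi) (s : ℂ) :
    Complex.exp w ^ s = Complex.exp (s * w) := by
  rw [abs_lt] at hw
  rw [Complex.cpow_def_of_ne_zero (Complex.exp_ne_zero w), Complex.log_exp hw.1 hw.2.le, mul_comm]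

end Continuation
end

theorem mainTheorem1 (a b c d : ℂ)
    -- no argument of a Gamma function or Pochhammer symbol is exceptional
    (ha : ∀ k : ℤ, a ≠ k) (hb : ∀ k : ℕ, b ≠ -(k : ℂ)) (hd : ∀ k : ℕ, d ≠ -(k : ℂ))
    (hda : ∀ k : ℕ, d - a ≠ -(k : ℂ)) (hdb : ∀ k : ℤ, d - b ≠ k)
    (habd : ∀ k : ℤ, a + b - d ≠ k) :
    -- convergence of the series of `H₁`
    (∀ x y : ℂ, (x, y) ∈ hornH1Region → Summable (hornH1Term a b c d x y)) ∧
    -- convergence of the two series in `1 - x` and `-y`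
    (∀ x y : ℂ, (x, y) ∈ at10Region →
      Summable (at10Term₁ a b c d x y) ∧ Summable (at10Term₂ a b c d x y)) ∧
    -- the identity between convergent series, principal branch of the power
    (∀ x y : ℂ, (x, y) ∈ hornH1Region → (x, y) ∈ at10Region →
      hornH1 a b c d x y = at10Sum a b c d ((1 - x) ^ (d - a - b)) x y) ∧
    -- the right-hand side is the analytic continuation of `H₁` to the whole region around `(1, 0)`,
    -- cut along the real half-line `x ≥ 1`
    (∃ F : ℂ × ℂ → ℂ,
      AnalyticOnNhd ℂ F
        (hornH1Region ∪ {q | q ∈ at10Region ∧ 1 - q.1 ∈ Complex.slitPlane}) ∧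
      ∀ x y : ℂ, (x, y) ∈ hornH1Region → F (x, y) = hornH1 a b c d x y) ∧
    (∀ F : ℂ × ℂ → ℂ,
      AnalyticOnNhd ℂ F
        (hornH1Region ∪ {q | q ∈ at10Region ∧ 1 - q.1 ∈ Complex.slitPlane}) →
      (∀ x y : ℂ, (x, y) ∈ hornH1Region → F (x, y) = hornH1 a b c d x y) →
      ∀ x y : ℂ, (x, y) ∈ at10Region → 1 - x ∈ Complex.slitPlane →
        F (x, y) = at10Sum a b c d ((1 - x) ^ (d - a - b)) x y) ∧
    -- the same for all branches at once: with `x = 1 - exp w`, where `w` is the logarithm of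
    -- `1 - x`, starting from the principal logarithm
    (∃ G : ℂ × ℂ → ℂ,
      AnalyticOnNhd ℂ G {q | (1 - Complex.exp q.1, q.2) ∈ at10Region} ∧
      ∀ w y : ℂ, (1 - Complex.exp w, y) ∈ at10Region → |w.im| < Real.pi →
        (1 - Complex.exp w, y) ∈ hornH1Region →
        G (w, y) = hornH1 a b c d (1 - Complex.exp w) y) ∧
    (∀ G : ℂ × ℂ → ℂ,
      AnalyticOnNhd ℂ G {q | (1 - Complex.exp q.1, q.2) ∈ at10Region} →
      (∀ w y : ℂ, (1 - Complex.exp w, y) ∈ at10Region → |w.im| < Real.pi →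
        (1 - Complex.exp w, y) ∈ hornH1Region →
        G (w, y) = hornH1 a b c d (1 - Complex.exp w) y) →
      ∀ w y : ℂ, (1 - Complex.exp w, y) ∈ at10Region →
        G (w, y) = at10Sum a b c d (Complex.exp ((d - a - b) * w)) (1 - Complex.exp w) y) := by
  have hb' : NonPole b := hb
  have hd' : NonPole d := hd
  have hda' : NonPole (d - a) := hda
  have key : ∀ x y : ℂ, (x, y) ∈ hornH1Region → (x, y) ∈ at10Region →
      hornH1 a b c d x y = at10Sum a b c d ((1 - x) ^ (d - a - b)) x y := fun x y h0 h1 =>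
    hornH1_eq_at10Sum ha hb' hd' hda' hdb habd h0 h1
  have keyLog : ∀ w y : ℂ, (1 - Complex.exp w, y) ∈ at10Region → |w.im| < Real.pi →
      (1 - Complex.exp w, y) ∈ hornH1Region →
      at10Sum a b c d (Complex.exp ((d - a - b) * w)) (1 - Complex.exp w) y =
        hornH1 a b c d (1 - Complex.exp w) y := fun w y h1 hw h0 => by
    rw [key _ _ h0 h1, sub_sub_cancel, exp_cpow_of_abs_im_lt hw]
  refine ⟨fun x y h => summable_hornH1Term a b c d h,
    fun x y h => ⟨summable_at10Term₁ a b c d h, summable_at10Term₂ a b c d h⟩, key,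
    ?_, ?_, ?_, ?_⟩
  -- The continuation of `hornH1` is obtained by gluing along the intersection of the regions.
  · classical
    refine ⟨fun q => if q ∈ hornH1Region then hornH1 a b c d q.1 q.2
      else at10Sum a b c d ((1 - q.1) ^ (d - a - b)) q.1 q.2, ?_, fun x y h => if_pos h⟩
    intro q hq
    by_cases hq0 : q ∈ hornH1Region
    · refine (analyticOnNhd_hornH1 a b c d q hq0).congr ?_
      filter_upwards [isOpen_hornH1Region.mem_nhds hq0] with r hr
      exact (if_pos hr).symm
    · have hq1 : q ∈ at10CutRegion := hq.resolve_left hq0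
      refine (analyticOnNhd_at10Sum_cut a b c d q hq1).congr ?_
      filter_upwards [isOpen_at10CutRegion.mem_nhds hq1] with r hr
      split_ifs with hr0
      · exact (key r.1 r.2 hr0 hr.1).symm
      · rfl
  · intro F hF hF0 x y h hx
    have hF' : AnalyticOnNhd ℂ F at10CutRegion := hF.mono Set.subset_union_right
    refine hF'.eqOn_of_preconnected_of_eventuallyEq (analyticOnNhd_at10Sum_cut a b c d)
      isPreconnected_at10CutRegion half_mem_at10CutRegion ?_
      (show (x, y) ∈ at10CutRegion from ⟨h, hx⟩)
    filter_upwards [isOpen_hornH1Region.mem_nhds half_mem.1,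
      isOpen_at10Region.mem_nhds half_mem.2] with r hr0 hr1
    rw [← key r.1 r.2 hr0 hr1]
    exact hF0 r.1 r.2 hr0
  · exact ⟨_, analyticOnNhd_at10Sum_log a b c d, keyLog⟩
  · intro G hG hG0 w y h
    refine hG.eqOn_of_preconnected_of_eventuallyEq (analyticOnNhd_at10Sum_log a b c d)
      isPreconnected_at10LogRegion log_half_mem_at10LogRegion ?_
      (show (w, y) ∈ at10LogRegion from h)
    have hH : IsOpen {q : ℂ × ℂ | (1 - Complex.exp q.1, q.2) ∈ hornH1Region} :=
      isOpen_hornH1Region.preimage (f := fun q : ℂ × ℂ => (1 - Complex.exp q.1, q.2)) (by fun_prop)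
    have hI : IsOpen {q : ℂ × ℂ | |q.1.im| < Real.pi} :=
      isOpen_lt (by fun_prop) continuous_const
    have h2 : (1 : ℂ) - 1 / 2 = 1 / 2 := by norm_num
    filter_upwards [isOpen_at10LogRegion.mem_nhds log_half_mem_at10LogRegion,
      hH.mem_nhds (x := (((Real.log (1 / 2) : ℝ) : ℂ), (0 : ℂ))) (by
        simpa only [Set.mem_ofPred_eq, exp_log_half, h2] using half_mem.1),
      hI.mem_nhds (x := (((Real.log (1 / 2) : ℝ) : ℂ), (0 : ℂ))) (by
        rw [Set.mem_ofPred_eq, Complex.ofReal_im, abs_zero]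
        exact Real.pi_pos)] with r hr1 hr0 hri
    rw [hG0 r.1 r.2 hr1 hri hr0]
    exact (keyLog r.1 r.2 hr1 hri hr0).symm
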